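/- Let $G$ be a compact connected Lie group with Lie algebra $\mathfrak g$ (the left-invariant vector fields on $G$, identified with $T_eG$), and let $X_1,\dots,X_m\in\mathfrak g$. A \emph{trajectory} of the left-invariant driftless system $$\mathbf x'=\sum_{k=1}^m u_kX_k(\mathbf x)\qquad(\ast)$$ is a tuple $(\mathbf x,u_1,\dots,u_m)$, where $u_1,\dots,u_m:\mathbb R\to\mathbb R$ are smooth and $\mathbf x:\mathbb R\to G$ satisfies $\mathbf x'(t)=\sum_k u_k(t)X_k(\mathbf x(t))$ for all $t\in\mathbb R$. Let $(\mathbf x_r,u_1^r,\dots,u_m^r)$ be a trajectory of $(\ast)$ that is $T$-periodic for some $T>0$ (all of $\mathbf x_r,u^r_1,\dots,u^r_m$ are $T$-periodic) and \emph{regular}, that is, $$\operatorname{span}\{\operatorname{Ad}(\mathbf x_r(t))X_k \;;\; t\in\mathbb R,\ 1\le k\le m\}=\mathfrak g.$$ Put $V(x)=\operatorname{tr}\operatorname{Ad}(x)$ for $x\in G$ and define, for $(t,w)\in\mathbb R\times G$, $$a_k(t,w)=\mathrm dV\big((\operatorname{Ad}(\mathbf x_r(t))X_k)(w)\big),\qquad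 W(t,w)=\sum_{k=1}^m a_k(t,w)\,(\operatorname{Ad}(\mathbf x_r(t))X_k)(w).$$ A point $x\in G$ is a \emph{local attractor} of the time-dependent vector field $W$ if $W(t,x)=0$ for all $t\in\mathbb R$ and there is a neighborhood $U$ of $x$ such that, for every $(t_0,w_0)\in\mathbb R\times U$, there is a unique integral curve $\mathbf w:\mathbb R\to G$ of $W$ with $\mathbf w(t_0)=w_0$, and it satisfies $\lim_{t\to\infty}\mathbf w(t)=x$. Assume that $G$ is semisimple (i.e. $\mathfrak g$ has no nonzero solvable ideal). Then: 1. every $x$ in the center $Z(G)$ is a local attractor of $W$; in particular, the identity $e$ is a local attractor of $W$; 2. there is a neighborhood $U_\infty$ of $\mathbf x_r(0)$ such that for every $x_0\in U_\infty$ there is a unique integral curve $\mathbf w:\mathbb R\to G$ of $W$ with $\mathbf w(0)=x_0\,\mathbf x_r(0)^{-1}$, and, setting $\mathbf x(t)=\mathbf w(t)\,\mathbf x_r(t)$ and $u_k(t)=a_k(t,\mathbf w(t))+u_k^r(t)$, the tuple $(\mathbf x,u_1,\dots,u_m)$ is a trajectory of $(\ast)$ with $\mathbf x(0)=x_0$ and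 $\lim_{t\to\infty}\mathbf x(t)\,\mathbf x_r(t)^{-1}=e$. -/

import Mathlib

open scoped Manifold ContDiff Topology

/-- A smooth real Lie group is in particular as smooth as needed for Mathlib's Lie bracket on its
tangent space at the identity. -/
instance instLEInftyMinSmoothnessRealThree : ENat.LEInfty (minSmoothness ℝ 3) :=
  ⟨by rw [minSmoothness_of_isRCLikeNormedField]; exact ENat.LEInfty.out⟩

namespace TrajectoryTracking

noncomputable section

variable {E : Type*} [NormedAddCommGroup E] [NormedSpace ℝ E]
  {H : Type*} [TopologicalSpace H] (I : ModelWithCorners ℝ E H)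
  {G : Type*} [TopologicalSpace G] [ChartedSpace H G] [Group G]

/-- `γ` is a (global) integral curve of the time-dependent vector field `Y`:
`γ' t = Y t (γ t)` for every `t`. -/
def IsIntegralCurve (Y : ℝ → (x : G) → TangentSpace I x) (γ : ℝ → G) : Prop :=
  ∀ t : ℝ, HasMFDerivAt 𝓘(ℝ, ℝ) I γ t ((1 : ℝ →L[ℝ] ℝ).smulRight (Y t (γ t)))

/-- `x` is a critical point of the time-dependent vector field `Y`. -/
def IsCriticalPoint (Y : ℝ → (x : G) → TangentSpace I x) (x : G) : Prop :=
  ∀ t : ℝ, Y t x = 0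

/-- `x` is a local attractor of the time-dependent vector field `Y`: it is a critical point, and it
has a neighbourhood `U` such that for every initial time `t₀` and initial state `x₀ ∈ U` there is
one and only one integral curve `γ` of `Y`, defined for all times, with `γ t₀ = x₀`, and this
curve satisfies `γ t → x` as `t → ∞`. -/
def IsLocalAttractor (Y : ℝ → (x : G) → TangentSpace I x) (x : G) : Prop :=
  IsCriticalPoint I Y x ∧
    ∃ U ∈ 𝓝 x, ∀ t₀ : ℝ, ∀ x₀ ∈ U,
      (∃! γ : ℝ → G, IsIntegralCurve I Y γ ∧ γ t₀ = x₀) ∧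
      ∀ γ : ℝ → G, IsIntegralCurve I Y γ → γ t₀ = x₀ → Filter.Tendsto γ Filter.atTop (𝓝 x)

/-- The adjoint map `Ad x : 𝔤 → 𝔤`, the differential at the identity of `y ↦ x * y * x⁻¹`
(the tangent spaces at `x * 1 * x⁻¹` and at `1` are the same). -/
def Ad (x : G) : GroupLieAlgebra I G →ₗ[ℝ] GroupLieAlgebra I G :=
  (mfderiv I I (fun y : G => x * y * x⁻¹) (1 : G) : E →L[ℝ] E).toLinearMap

/-- The Lyapunov-like function `V x = tr (Ad x)`. -/
def lyapunov (x : G) : ℝ :=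
  LinearMap.trace ℝ (GroupLieAlgebra I G) (Ad I x)

variable {m : ℕ}

/-- `(x, u₁, …, uₘ)` is a (smooth) trajectory of the left-invariant driftless system
`x' = ∑ k, uₖ Xₖ(x)`. A vector of `𝔤 = T_e G` stands for the left-invariant vector field it
generates. -/
structure IsTrajectory (X : Fin m → GroupLieAlgebra I G) (x : ℝ → G) (u : Fin m → ℝ → ℝ) :
    Prop where
  smooth : ∀ k, ContDiff ℝ ∞ (u k)
  integralCurve :
    IsIntegralCurve I (fun t y => ∑ k, u k t • mulInvariantVectorField (I := I) (X k) y) x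

/-- `x` and all the controls `u k` are `T`-periodic. -/
def IsPeriodicTrajectory (T : ℝ) (x : ℝ → G) (u : Fin m → ℝ → ℝ) : Prop :=
  Function.Periodic x T ∧ ∀ k, Function.Periodic (u k) T

/-- Regularity: the vectors `Ad (x t) Xₖ`, for all `t` and `k`, span the Lie algebra. -/
def IsRegular (X : Fin m → GroupLieAlgebra I G) (x : ℝ → G) : Prop :=
  Submodule.span ℝ {v : GroupLieAlgebra I G | ∃ (t : ℝ) (k : Fin m), v = Ad I (x t) (X k)} = ⊤

/-- The coefficient `aₖ(t, w) = dV (Ad (xr t) Xₖ (w))`. -/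
def auxCoeff (X : Fin m → GroupLieAlgebra I G) (xr : ℝ → G) (k : Fin m) (t : ℝ) (w : G) : ℝ :=
  mvfderiv I (lyapunov I : G → ℝ) w
    (mulInvariantVectorField (I := I) (Ad I (xr t) (X k)) w)

/-- The auxiliary vector field `W(t, w) = ∑ k, aₖ(t, w) Ad (xr t) Xₖ (w)`. -/
def auxField (X : Fin m → GroupLieAlgebra I G) (xr : ℝ → G) (t : ℝ) (w : G) : TangentSpace I w :=
  ∑ k, auxCoeff I X xr k t w • mulInvariantVectorField (I := I) (Ad I (xr t) (X k)) w

/-- `(x, u₁, …, uₘ)` solves the tracking problem for the reference curve `xr` and the initial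
state `x₀`. -/
structure SolvesTracking (X : Fin m → GroupLieAlgebra I G) (xr : ℝ → G) (x₀ : G)
    (x : ℝ → G) (u : Fin m → ℝ → ℝ) : Prop where
  trajectory : IsTrajectory I X x u
  initial : x 0 = x₀
  tracks : Filter.Tendsto (fun t => x t * (xr t)⁻¹) Filter.atTop (𝓝 1)

end

end TrajectoryTracking

namespace TrajectoryTracking

noncomputable section

section Adjoint

variable {E : Type*} [NormedAddCommGroup E] [NormedSpace ℝ E]
  {H : Type*} [TopologicalSpace H] (I : ModelWithCorners ℝ E H)
  {G : Type*} [TopologicalSpace G] [ChartedSpace H G] [Group G]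

/-- The adjoint map `Ad x` as a continuous linear map of the model space. -/
def adCLM (x : G) : E →L[ℝ] E := mfderiv I I (fun y : G => x * y * x⁻¹) (1 : G)

/-- The differential at the identity of left multiplication by `x`. -/
def leftCLM (x : G) : E →L[ℝ] E := mfderiv I I (fun y : G => x * y) (1 : G)

lemma adCLM_of_mem_center {z : G} (hz : z ∈ Subgroup.center G) :
    adCLM I z = ContinuousLinearMap.id ℝ E := by
  have : (fun y : G => z * y * z⁻¹) = id := by
    ext y
    rw [← Subgroup.mem_center_iff.1 hz y]; simp
  unfold adCLM
  rw [this]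
  exact mfderiv_id


lemma adCLM_one : adCLM I (1 : G) = ContinuousLinearMap.id ℝ E :=
  adCLM_of_mem_center I (Subgroup.one_mem _)

variable [LieGroup I ∞ G]

lemma mdifferentiable_conj (x : G) : MDifferentiable I I (fun y : G => x * y * x⁻¹) := by
  have : ContMDiff I I ∞ (fun y : G => x * y * x⁻¹) :=
    (contMDiff_const.mul contMDiff_id).mul contMDiff_const
  exact this.mdifferentiable (by simp)

lemma hasMFDerivAt_conj (x : G) :
    HasMFDerivAt I I (fun y : G => x * y * x⁻¹) (1 : G) (adCLM I x : E →L[ℝ] E) :=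
  (mdifferentiable_conj I x 1).hasMFDerivAt

lemma mdifferentiable_mul_left (x : G) : MDifferentiable I I (fun y : G => x * y) := by
  have : ContMDiff I I ∞ (fun y : G => x * y) := (contMDiff_const.mul contMDiff_id)
  exact this.mdifferentiable (by simp)

lemma hasMFDerivAt_mul_left (x : G) :
    HasMFDerivAt I I (fun y : G => x * y) (1 : G) (leftCLM I x : E →L[ℝ] E) :=
  (mdifferentiable_mul_left I x 1).hasMFDerivAt

lemma adCLM_mul (x y : G) : adCLM I (x * y) = (adCLM I x).comp (adCLM I y) := by
  have h1 := hasMFDerivAt_conj I y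
  have h2 : HasMFDerivAt I I (fun y : G => x * y * x⁻¹) ((fun z : G => y * z * y⁻¹) 1)
      (adCLM I x : E →L[ℝ] E) := by
    have := hasMFDerivAt_conj I x
    have e : (fun z : G => y * z * y⁻¹) 1 = 1 := by simp
    rw [e]; exact this
  have h3 := h2.comp 1 h1
  have e : (fun y : G => x * y * x⁻¹) ∘ (fun z : G => y * z * y⁻¹) =
     fun z => (x * y) * z * (x * y)⁻¹ := by ext z; simp [mul_assoc]
  rw [e] at h3
  exact h3.mfderiv

lemma contMDiff_adCLM : ContMDiff I 𝓘(ℝ, E →L[ℝ] E) ∞ (adCLM I : G → E →L[ℝ] E) := by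
  intro x₀
  have h : ContMDiffAt (I.prod I) I ∞
      (Function.uncurry fun (x y : G) => x * y * x⁻¹) (x₀, 1) := by
    have : ContMDiff (I.prod I) I ∞ (fun p : G × G => p.1 * p.2 * p.1⁻¹) :=
      (contMDiff_fst.mul contMDiff_snd).mul contMDiff_fst.inv
    exact this _
  have h2 : ContMDiffAt I 𝓘(ℝ, E →L[ℝ] E) ∞ (inTangentCoordinates I I (fun _ : G => (1 : G))
      (fun x : G => x * 1 * x⁻¹) (adCLM I) x₀) x₀ :=
    ContMDiffAt.mfderiv (m := ∞) (fun (x y : G) => x * y * x⁻¹) (fun _ => (1 : G)) h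
    contMDiffAt_const (by simp)
  refine h2.congr_of_eventuallyEq (Filter.Eventually.of_forall fun x => ?_)
  have e (x : G) : x * 1 * x⁻¹ = 1 := by simp
  rw [inTangentCoordinates_eq _ _ _ (by simp) (by simp)]
  simp only [e]
  ext v
  have c (v : E) : (tangentBundleCore I G).coordChange (achart H 1) (achart H 1) 1 v = v :=
    (tangentBundleCore I G).coordChange_self (achart H 1) 1 (mem_chart_source H 1) v
  simp only [ContinuousLinearMap.comp_apply, c]

end Adjoint

section AdjointDerivative

variable {E : Type*} [NormedAddCommGroup E] [NormedSpace ℝ E]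
  {H : Type*} [TopologicalSpace H] (I : ModelWithCorners ℝ E H)

/-- The trace as a continuous linear form on the endomorphisms of a finite-dimensional space. -/
def trCLM (E : Type*) [NormedAddCommGroup E] [NormedSpace ℝ E] [FiniteDimensional ℝ E] :
    (E →L[ℝ] E) →L[ℝ] ℝ :=
  LinearMap.toContinuousLinearMap (LinearMap.trace ℝ E ∘ₗ ContinuousLinearMap.coeLM ℝ)

lemma trCLM_apply [FiniteDimensional ℝ E] (f : E →L[ℝ] E) :
    trCLM E f = LinearMap.trace ℝ E (f : E →ₗ[ℝ] E) := rfl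

variable {G : Type*} [TopologicalSpace G] [ChartedSpace H G] [Group G]

/-- The differential at `w` of the adjoint representation. -/
def dAdAt (w : G) : E →L[ℝ] E →L[ℝ] E :=
  mfderiv I 𝓘(ℝ, E →L[ℝ] E) (adCLM I : G → E →L[ℝ] E) w

/-- The differential at the identity of the adjoint representation. -/
def dAd (G : Type*) [TopologicalSpace G] [ChartedSpace H G] [Group G] : E →L[ℝ] E →L[ℝ] E :=
  dAdAt I (1 : G)

variable [LieGroup I ∞ G]

lemma hasMFDerivAt_adCLM (w : G) :
    HasMFDerivAt I 𝓘(ℝ, E →L[ℝ] E) (adCLM I : G → E →L[ℝ] E) w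
      (dAdAt I w : E →L[ℝ] E →L[ℝ] E) :=
  ((contMDiff_adCLM I).mdifferentiable (by simp) w).hasMFDerivAt

lemma dAdAt_leftCLM (w : G) (Y : E) :
    dAdAt I w (leftCLM I w Y) = (adCLM I w).comp (dAd I G Y) := by
  have h1 : HasMFDerivAt I 𝓘(ℝ, E →L[ℝ] E) (adCLM I : G → E →L[ℝ] E) ((fun y : G => w * y) 1)
      (dAdAt I w : E →L[ℝ] E →L[ℝ] E) := by
    have e : (fun y : G => w * y) 1 = w := by simp
    rw [e]
    exact hasMFDerivAt_adCLM I w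
  have h2 := h1.comp 1 (hasMFDerivAt_mul_left I w)
  have h3 : HasMFDerivAt I 𝓘(ℝ, E →L[ℝ] E)
      ((ContinuousLinearMap.compL ℝ E E E (adCLM I w)) ∘ (adCLM I : G → E →L[ℝ] E)) (1 : G)
      ((ContinuousLinearMap.compL ℝ E E E (adCLM I w)).comp (dAd I G) : E →L[ℝ] E →L[ℝ] E) :=
    (ContinuousLinearMap.hasMFDerivAt _).comp 1 (hasMFDerivAt_adCLM I 1)
  have e : (adCLM I : G → E →L[ℝ] E) ∘ (fun y : G => w * y) =
      (ContinuousLinearMap.compL ℝ E E E (adCLM I w)) ∘ (adCLM I : G → E →L[ℝ] E) := by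
    ext1 y; simp [adCLM_mul]
  rw [e] at h2
  have h4 : (dAdAt I w).comp (leftCLM I w) =
      (ContinuousLinearMap.compL ℝ E E E (adCLM I w)).comp (dAd I G) :=
    hasMFDerivAt_unique h2 h3
  exact DFunLike.congr_fun h4 Y

lemma hasDerivAt_adCLM_comp {γ : ℝ → G} {t : ℝ} {ξ : E}
    (h : HasMFDerivAt 𝓘(ℝ, ℝ) I γ t
      ((1 : ℝ →L[ℝ] ℝ).smulRight (leftCLM I (γ t) ξ) : ℝ →L[ℝ] E)) :
    HasDerivAt (fun s => adCLM I (γ s)) ((adCLM I (γ t)).comp (dAd I G ξ)) t := by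
  have h1 : HasFDerivAt (fun s => adCLM I (γ s)) ((dAdAt I (γ t)).comp
      ((1 : ℝ →L[ℝ] ℝ).smulRight (leftCLM I (γ t) ξ) : ℝ →L[ℝ] E)) t :=
    ((hasMFDerivAt_adCLM I (γ t)).comp t h).hasFDerivAt
  simpa [dAdAt_leftCLM] using h1.hasDerivAt

variable [FiniteDimensional ℝ E]

lemma mvfderiv_lyapunov (w : G) (Y : E) :
    (mvfderiv I (lyapunov I : G → ℝ) w : E →L[ℝ] ℝ) (leftCLM I w Y) =
      trCLM E ((adCLM I w).comp (dAd I G Y)) := by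
  have h2 : HasMFDerivAt I 𝓘(ℝ, ℝ) (lyapunov I : G → ℝ) w
      ((trCLM E).comp (dAdAt I w) : E →L[ℝ] ℝ) :=
    (ContinuousLinearMap.hasMFDerivAt (trCLM E)).comp w (hasMFDerivAt_adCLM I w)
  have h3 : (mvfderiv I (lyapunov I : G → ℝ) w : E →L[ℝ] ℝ) (leftCLM I w Y) =
      ((trCLM E).comp (dAdAt I w)) (leftCLM I w Y) := DFunLike.congr_fun h2.mfderiv _
  rw [h3, ContinuousLinearMap.comp_apply, dAdAt_leftCLM]

lemma auxCoeff_eq {m : ℕ} (X : Fin m → GroupLieAlgebra I G) (xr : ℝ → G) (k : Fin m) (t : ℝ)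
    (w : G) : auxCoeff I X xr k t w =
      trCLM E ((adCLM I w).comp (dAd I G (adCLM I (xr t) (X k : E)))) :=
  mvfderiv_lyapunov I w _

end AdjointDerivative

section BracketFormula

variable {E : Type*} [NormedAddCommGroup E] [NormedSpace ℝ E]
  {H : Type*} [TopologicalSpace H] (I : ModelWithCorners ℝ E H)

/-- The group law read in the preferred chart at the identity. -/
def chartMul (G : Type*) [TopologicalSpace G] [ChartedSpace H G] [Group G] (p : E × E) : E :=
  extChartAt I (1 : G) ((extChartAt I (1 : G)).symm p.1 * (extChartAt I (1 : G)).symm p.2)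

variable {G : Type*} [TopologicalSpace G] [ChartedSpace H G] [Group G]

/-- The differential at `x` of the preferred chart at the identity. -/
def chartD (x : G) : E →L[ℝ] E := mfderiv I 𝓘(ℝ, E) (extChartAt I (1 : G)) x

variable [LieGroup I ∞ G]

lemma hasMFDerivAt_chart {x : G} (hx : x ∈ (extChartAt I (1 : G)).source) :
    HasMFDerivAt I 𝓘(ℝ, E) (extChartAt I (1 : G)) x (chartD I x : E →L[ℝ] E) :=
  (mdifferentiableAt_extChartAt (by simpa using hx)).hasMFDerivAt

lemma chartD_one : chartD I (1 : G) = ContinuousLinearMap.id ℝ E := mfderiv_extChartAt_self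

variable [I.Boundaryless]

lemma hasMFDerivAt_chart_symm_one :
    HasMFDerivAt 𝓘(ℝ, E) I (extChartAt I (1 : G)).symm (extChartAt I (1 : G) 1)
      (ContinuousLinearMap.id ℝ E : E →L[ℝ] E) := by
  have h1 := (mdifferentiableWithinAt_extChartAt_symm (I := I)
    (mem_extChartAt_target (I := I) (1 : G))).hasMFDerivWithinAt
  rw [mfderivWithin_range_extChartAt_symm, I.range_eq_univ] at h1
  exact h1.hasMFDerivAt Filter.univ_mem

lemma contDiffAt_chartMul {u v : E} (hu : u ∈ (extChartAt I (1 : G)).target)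
    (hv : v ∈ (extChartAt I (1 : G)).target)
    (huv : (extChartAt I (1 : G)).symm u * (extChartAt I (1 : G)).symm v ∈
      (extChartAt I (1 : G)).source) : ContDiffAt ℝ ∞ (chartMul I G) (u, v) := by
  have hs {u : E} (hu : u ∈ (extChartAt I (1 : G)).target) :
      ContMDiffAt 𝓘(ℝ, E) I ∞ (extChartAt I (1 : G)).symm u :=
    (contMDiffOn_extChartAt_symm (I := I) (n := ∞) (1 : G)).contMDiffAt
      ((isOpen_extChartAt_target (I := I) (1 : G)).mem_nhds hu)
  have h1 : ContMDiffAt (𝓘(ℝ, E).prod 𝓘(ℝ, E)) 𝓘(ℝ, E) ∞ (chartMul I G) (u, v) := by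
    refine ContMDiffAt.comp (I' := I) (u, v)
      (contMDiffAt_extChartAt' (by simpa using huv)) (ContMDiffAt.mul ?_ ?_)
    · exact (hs hu).comp (u, v) contMDiffAt_fst
    · exact (hs hv).comp (u, v) contMDiffAt_snd
  rw [← modelWithCornersSelf_prod, chartedSpaceSelf_prod] at h1
  exact h1.contDiffAt

lemma hasFDerivAt_chartMul_left {u : E} (hu : u ∈ (extChartAt I (1 : G)).target) :
    HasFDerivAt (fun v => chartMul I G (u, v))
      ((chartD I ((extChartAt I (1 : G)).symm u)).comp (leftCLM I ((extChartAt I (1 : G)).symm u)))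
      (extChartAt I (1 : G) 1) := by
  set x := (extChartAt I (1 : G)).symm u with hx
  have hxs : x ∈ (extChartAt I (1 : G)).source := (extChartAt I (1 : G)).map_target hu
  have h1 : HasMFDerivAt I I (fun y : G => x * y) ((extChartAt I (1 : G)).symm
      (extChartAt I (1 : G) 1)) (leftCLM I x : E →L[ℝ] E) := by
    rw [extChartAt_to_inv]
    exact hasMFDerivAt_mul_left I x
  have h2 := h1.comp _ (hasMFDerivAt_chart_symm_one I)
  have h3 : HasMFDerivAt I 𝓘(ℝ, E) (extChartAt I (1 : G)) (((fun y : G => x * y) ∘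
      (extChartAt I (1 : G)).symm) (extChartAt I (1 : G) 1)) (chartD I x : E →L[ℝ] E) := by
    have e : ((fun y : G => x * y) ∘
      (extChartAt I (1 : G)).symm) (extChartAt I (1 : G) 1) = x := by simp
    rw [e]
    exact hasMFDerivAt_chart I hxs
  exact (h3.comp _ h2).hasFDerivAt

lemma mpullbackWithin_mulInvariantVectorField {u : E} (hu : u ∈ (extChartAt I (1 : G)).target)
    (X : GroupLieAlgebra I G) :
    (VectorField.mpullbackWithin 𝓘(ℝ, E) I (extChartAt I (1 : G)).symm
      (mulInvariantVectorField X) (Set.range I) u : E) =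
      fderiv ℝ (chartMul I G) (u, extChartAt I (1 : G) 1) (0, (X : E)) := by
  have e1 : (VectorField.mpullbackWithin 𝓘(ℝ, E) I (extChartAt I (1 : G)).symm
      (mulInvariantVectorField X) (Set.range I) u : E) =
      chartD I ((extChartAt I (1 : G)).symm u) (leftCLM I ((extChartAt I (1 : G)).symm u) X) := by
    have := ContinuousLinearMap.inverse_eq
      (mfderivWithin_extChartAt_symm_comp_mfderiv_extChartAt hu)
      (mfderiv_extChartAt_comp_mfderivWithin_extChartAt_symm hu)
    exact DFunLike.congr_fun this _
  have h2 := (contDiffAt_chartMul I hu (mem_extChartAt_target (I := I) (1 : G)) (by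
    simpa using (extChartAt I (1 : G)).map_target hu)).differentiableAt (by simp)
  have h3 := h2.hasFDerivAt.comp (extChartAt I (1 : G) 1)
    (hasFDerivAt_prodMk_right u (extChartAt I (1 : G) 1))
  have := h3.unique (hasFDerivAt_chartMul_left I hu)
  rw [e1]
  exact (DFunLike.congr_fun this X).symm

lemma fderiv_chartMul_adCLM {u : E} (hu : u ∈ (extChartAt I (1 : G)).target) (Y : E) :
    fderiv ℝ (chartMul I G) (u, extChartAt I (1 : G) 1) (0, Y) =
      fderiv ℝ (chartMul I G) (extChartAt I (1 : G) 1, u)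
        (adCLM I ((extChartAt I (1 : G)).symm u) Y, 0) := by
  set x := (extChartAt I (1 : G)).symm u with hx
  set e₀ := extChartAt I (1 : G) 1 with he₀
  have he : e₀ ∈ (extChartAt I (1 : G)).target := mem_extChartAt_target (I := I) (1 : G)
  have hxs : x ∈ (extChartAt I (1 : G)).source := (extChartAt I (1 : G)).map_target hu
  let κ : E → E := (extChartAt I (1 : G)) ∘ ((fun y : G => x * y * x⁻¹) ∘
    (extChartAt I (1 : G)).symm)
  have hc : ((fun y : G => x * y * x⁻¹) ∘ (extChartAt I (1 : G)).symm) e₀ = 1 := by simp [he₀]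
  have h1 : HasMFDerivAt I I (fun y : G => x * y * x⁻¹) ((extChartAt I (1 : G)).symm e₀)
      (adCLM I x : E →L[ℝ] E) := by
    rw [extChartAt_to_inv]
    exact hasMFDerivAt_conj I x
  have h2 := h1.comp _ (hasMFDerivAt_chart_symm_one I)
  have h3 : HasMFDerivAt I 𝓘(ℝ, E) (extChartAt I (1 : G)) (((fun y : G => x * y * x⁻¹) ∘
      (extChartAt I (1 : G)).symm) e₀) (ContinuousLinearMap.id ℝ E : E →L[ℝ] E) := by
    rw [hc, ← chartD_one I (G := G)]
    exact hasMFDerivAt_chart I (mem_extChartAt_source (I := I) (1 : G))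
  have hκ : HasFDerivAt κ (adCLM I x) e₀ := (h3.comp _ h2).hasFDerivAt
  have hκ0 : κ e₀ = e₀ := by simp [κ, he₀]
  have d1 := (contDiffAt_chartMul I hu he (by rwa [he₀, extChartAt_to_inv, mul_one]))
    |>.differentiableAt (by simp)
  have d2 := (contDiffAt_chartMul I he hu (by rwa [he₀, extChartAt_to_inv, one_mul]))
    |>.differentiableAt (by simp)
  have f1 := d1.hasFDerivAt.comp e₀ (hasFDerivAt_prodMk_right u e₀)
  have d2' : HasFDerivAt (chartMul I G) (fderiv ℝ (chartMul I G) (e₀, u)) (κ e₀, u) := by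
    rw [hκ0]; exact d2.hasFDerivAt
  have f2 := d2'.comp e₀ (hκ.prodMk (hasFDerivAt_const u e₀))
  have ev : (chartMul I G ∘ fun v => (u, v)) =ᶠ[𝓝 e₀] (chartMul I G ∘ fun v => (κ v, u)) := by
    have hcont := h2.continuousAt
    have : ∀ᶠ v in 𝓝 e₀, ((fun y : G => x * y * x⁻¹) ∘ (extChartAt I (1 : G)).symm) v ∈
        (extChartAt I (1 : G)).source :=
      hcont.preimage_mem_nhds (by rw [hc]; exact extChartAt_source_mem_nhds (I := I) (1 : G))
    filter_upwards [this] with v hv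
    simp only [Function.comp_apply] at hv
    simp only [chartMul, Function.comp_apply, κ]
    rw [(extChartAt I (1 : G)).left_inv hv, ← hx]
    simp
  have := f1.unique (f2.congr_of_eventuallyEq ev)
  exact DFunLike.congr_fun this Y

lemma hasFDerivAt_adCLM_chart_symm :
    HasFDerivAt (fun u => adCLM I ((extChartAt I (1 : G)).symm u)) (dAd I G)
      (extChartAt I (1 : G) 1) := by
  have h1 : HasMFDerivAt I 𝓘(ℝ, E →L[ℝ] E) (adCLM I : G → E →L[ℝ] E)
      ((extChartAt I (1 : G)).symm (extChartAt I (1 : G) 1)) (dAd I G : E →L[ℝ] E →L[ℝ] E) := by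
    rw [extChartAt_to_inv]
    exact hasMFDerivAt_adCLM I 1
  exact (h1.comp _ (hasMFDerivAt_chart_symm_one I)).hasFDerivAt

/-- The differential of the adjoint representation is the Lie bracket. -/
theorem lie_eq_dAd [CompleteSpace E] (X Y : GroupLieAlgebra I G) :
    ⁅X, Y⁆ = dAd I G (X : E) (Y : E) := by
  set e₀ := extChartAt I (1 : G) 1 with he₀
  have he : e₀ ∈ (extChartAt I (1 : G)).target := mem_extChartAt_target (I := I) (1 : G)
  have hnh : (extChartAt I (1 : G)).target ∈ 𝓝 e₀ :=
    (isOpen_extChartAt_target (I := I) (1 : G)).mem_nhds he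
  set F := fderiv ℝ (chartMul I G) with hF
  have hμ : ContDiffAt ℝ ∞ (chartMul I G) (e₀, e₀) :=
    contDiffAt_chartMul I he he (by simp [he₀])
  have hFd : HasFDerivAt F (fderiv ℝ F (e₀, e₀)) (e₀, e₀) :=
    ((hμ.fderiv_right (m := 1) (by norm_cast)).differentiableAt (by simp)).hasFDerivAt
  set Q := fderiv ℝ F (e₀, e₀) with hQ
  have hsymm : ∀ a b, Q a b = Q b a := (hμ.isSymmSndFDerivAt (by simpa using ENat.LEInfty.out)).eq
  -- the left-invariant fields in the chart
  let P : E → E → E := fun Z u => F (u, e₀) (0, Z)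
  have hP (Z : E) : HasFDerivAt (P Z) ((ContinuousLinearMap.apply ℝ E ((0 : E), Z)).comp
      (Q.comp (ContinuousLinearMap.inl ℝ E E))) e₀ :=
    (ContinuousLinearMap.apply ℝ E ((0 : E), Z)).hasFDerivAt.comp e₀
      (hFd.comp (f := fun u => (u, e₀)) e₀ (hasFDerivAt_prodMk_left e₀ e₀))
  have hP' (Z W : E) : fderiv ℝ (P Z) e₀ W = Q (W, 0) (0, Z) := by rw [(hP Z).fderiv]; rfl
  have hinr (Z : E) : F (e₀, e₀) (0, Z) = Z := by
    have h1 := (hμ.differentiableAt (by simp)).hasFDerivAt.comp e₀ (hasFDerivAt_prodMk_right e₀ e₀)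
    have h2 : (chartMul I G ∘ fun v => (e₀, v)) =ᶠ[𝓝 e₀] id := by
      filter_upwards [hnh] with v hv
      simp only [chartMul, he₀, extChartAt_to_inv, one_mul, id, Function.comp_apply,
        (extChartAt I (1 : G)).right_inv hv]
    exact DFunLike.congr_fun (h1.unique ((hasFDerivAt_id e₀).congr_of_eventuallyEq h2)) Z
  have hinl (Z : E) : F (e₀, e₀) (Z, 0) = Z := by
    have h1 := (hμ.differentiableAt (by simp)).hasFDerivAt.comp
      (f := fun u => (u, e₀)) e₀ (hasFDerivAt_prodMk_left e₀ e₀)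
    have h2 : (chartMul I G ∘ fun v => (v, e₀)) =ᶠ[𝓝 e₀] id := by
      filter_upwards [hnh] with v hv
      simp only [chartMul, he₀, extChartAt_to_inv, mul_one, id, Function.comp_apply,
        (extChartAt I (1 : G)).right_inv hv]
    exact DFunLike.congr_fun (h1.unique ((hasFDerivAt_id e₀).congr_of_eventuallyEq h2)) Z
  -- the derivative of `Ad` in the chart
  have hα := hasFDerivAt_adCLM_chart_symm I (G := G)
  have key (Z W : E) : Q (W, 0) (0, Z) = Q (0, W) (Z, 0) + dAd I G W Z := by
    have ev : P Z =ᶠ[𝓝 e₀] fun u => F (e₀, u) (adCLM I ((extChartAt I (1 : G)).symm u) Z, 0) := by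
      filter_upwards [hnh] with u hu
      exact fderiv_chartMul_adCLM I hu Z
    have h1 : HasFDerivAt (fun u => (adCLM I ((extChartAt I (1 : G)).symm u) Z, (0 : E)))
        (((ContinuousLinearMap.inl ℝ E E).comp (ContinuousLinearMap.apply ℝ E Z)).comp (dAd I G))
        e₀ :=
      ((ContinuousLinearMap.inl ℝ E E).comp (ContinuousLinearMap.apply ℝ E Z)).hasFDerivAt.comp
        e₀ hα
    have h2 := (hFd.comp e₀ (hasFDerivAt_prodMk_right e₀ e₀)).clm_apply h1
    have h3 := (hP Z).unique (h2.congr_of_eventuallyEq ev)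
    have h4 := DFunLike.congr_fun h3 W
    have h5 : adCLM I ((extChartAt I (1 : G)).symm e₀) = ContinuousLinearMap.id ℝ E := by
      rw [he₀, extChartAt_to_inv, adCLM_one]
    simp only [Function.comp_apply, ContinuousLinearMap.comp_apply, add_apply,
      ContinuousLinearMap.flip_apply, h5, ContinuousLinearMap.inl_apply,
      ContinuousLinearMap.apply_apply, ContinuousLinearMap.inr_apply, ContinuousLinearMap.id_apply,
      hinl] at h4
    rw [h4, add_comm]
  let Pb : GroupLieAlgebra I G → E → E := fun Z => VectorField.mpullbackWithin 𝓘(ℝ, E) I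
      (extChartAt I (1 : G)).symm (mulInvariantVectorField Z) (Set.range I)
  have eP (Z : GroupLieAlgebra I G) : Pb Z =ᶠ[𝓝 e₀] P Z := by
    filter_upwards [hnh] with u hu
    exact mpullbackWithin_mulInvariantVectorField I hu Z
  have hb : ⁅X, Y⁆ = (VectorField.lieBracket ℝ (P X) (P Y) e₀ : E) := by
    have hinv : (chartD I (1 : G)).inverse = ContinuousLinearMap.id ℝ E := by
      rw [chartD_one, ContinuousLinearMap.inverse_id]
    have hset : (extChartAt I (1 : G)).symm ⁻¹' Set.univ ∩ Set.range I = Set.univ := by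
      simp [I.range_eq_univ]
    have hinner (s : Set E) (hs : s = Set.univ) : (chartD I (1 : G)).inverse
        (VectorField.lieBracketWithin ℝ (Pb X) (Pb Y) s e₀) =
        VectorField.lieBracket ℝ (P X) (P Y) e₀ := by
      rw [hinv, hs, VectorField.lieBracketWithin_univ,
        (eP X).lieBracket_vectorField_eq (eP Y)]
      rfl
    exact hinner _ hset
  have hfin (Z W : E) : (VectorField.lieBracket ℝ (P Z) (P W) e₀ : E) = dAd I G Z W := by
    have hP0 (Z : E) : P Z e₀ = Z := hinr Z
    rw [VectorField.lieBracket, hP', hP', hP0, hP0, key, hsymm]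
    simp
  exact hb.trans (hfin X Y)

lemma eq_zero_of_dAd_eq_zero [CompleteSpace E]
    [LieAlgebra.HasTrivialRadical ℝ (GroupLieAlgebra I G)]
    {X : GroupLieAlgebra I G} (h : dAd I G (X : E) = 0) : X = 0 := by
  have hc : X ∈ LieAlgebra.center ℝ (GroupLieAlgebra I G) := by
    rw [LieModule.mem_maxTrivSubmodule]
    intro Y
    have h1 : ⁅X, Y⁆ = 0 := (lie_eq_dAd I X Y).trans (DFunLike.congr_fun h (Y : E))
    rw [← lie_skew, h1, neg_zero]
  rw [LieAlgebra.center_eq_bot] at hc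
  exact hc

end BracketFormula

section LinearAlgebra

/-- A positive definite symmetric bilinear form on a finite-dimensional real vector space has an
orthonormal basis. -/
lemma exists_orthonormal_basis_of_posDef {F : Type*} [AddCommGroup F] [Module ℝ F]
    [FiniteDimensional ℝ F] (β : F →ₗ[ℝ] F →ₗ[ℝ] ℝ) (hsymm : ∀ u v, β u v = β v u)
    (hpos : ∀ u, u ≠ 0 → 0 < β u u) :
    ∃ b : Module.Basis (Fin (Module.finrank ℝ F)) ℝ F,
      ∀ i j, β (b i) (b j) = if i = j then 1 else 0 := by
  let core : InnerProductSpace.Core ℝ F :=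
    { inner := fun u v => β u v
      conj_inner_symm := fun u v => by simp [hsymm v u]
      re_inner_nonneg := fun u => by
        by_cases hu : u = 0
        · simp [hu]
        · exact (hpos u hu).le
      add_left := fun u v w => by simp
      smul_left := fun u v r => by simp
      definite := fun u h => by
        by_contra hu
        exact (hpos u hu).ne' h }
  let : NormedAddCommGroup F := core.toNormedAddCommGroup
  let : InnerProductSpace ℝ F := InnerProductSpace.ofCore core.toCore
  let b := stdOrthonormalBasis ℝ F
  refine ⟨b.toBasis, fun i j => ?_⟩
  have := orthonormal_iff_ite.1 b.orthonormal i j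
  rw [OrthonormalBasis.coe_toBasis]
  exact this

lemma trace_le_of_transpose_mul_self_eq_one {n : ℕ} (M : Matrix (Fin n) (Fin n) ℝ)
    (h : M.transpose * M = 1) : M.trace ≤ n := by
  have h1 (i : Fin n) : M i i ≤ 1 := by
    have h2 := congrFun (congrFun h i) i
    rw [Matrix.mul_apply, Matrix.one_apply_eq] at h2
    have h3 : M i i * M i i ≤ ∑ j, M.transpose i j * M j i :=
      Finset.single_le_sum (f := fun j => M.transpose i j * M j i)
        (fun j _ => mul_self_nonneg (M j i)) (Finset.mem_univ i)
    nlinarith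
  calc M.trace = ∑ i, M i i := rfl
    _ ≤ ∑ _i : Fin n, (1 : ℝ) := Finset.sum_le_sum fun i _ => h1 i
    _ = n := by simp

lemma eq_zero_of_transpose_eq_neg {n : ℕ} (M : Matrix (Fin n) (Fin n) ℝ)
    (h : M.transpose = -M) (ht : (M * M).trace = 0) : M = 0 := by
  have h1 : (M.transpose * M).trace = 0 := by rw [h]; simp [ht]
  have h2 : M.conjTranspose * M = 0 := by
    rw [Matrix.conjTranspose_eq_transpose_of_trivial]
    have := (Matrix.posSemidef_conjTranspose_mul_self M).trace_eq_zero_iff.1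
      (by rw [Matrix.conjTranspose_eq_transpose_of_trivial]; exact h1)
    rwa [Matrix.conjTranspose_eq_transpose_of_trivial] at this
  exact Matrix.conjTranspose_mul_self_eq_zero.1 h2

end LinearAlgebra

variable {E : Type*} [NormedAddCommGroup E] [NormedSpace ℝ E] [FiniteDimensional ℝ E]
  {H : Type*} [TopologicalSpace H] (I : ModelWithCorners ℝ E H)
  (G : Type*) [TopologicalSpace G] [ChartedSpace H G] [Group G] [LieGroup I ∞ G] [CompactSpace G]
open MeasureTheory

/-- The Lie algebra of a compact Lie group carries an inner product invariant under the adjoint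
representation. -/
lemma exists_invariant_form : ∃ β : E →ₗ[ℝ] E →ₗ[ℝ] ℝ, (∀ u v, β u v = β v u) ∧
    (∀ u, u ≠ 0 → 0 < β u u) ∧
    ∀ (x : G) (u v : E), β (adCLM I x u) (adCLM I x v) = β u v := by
  have : IsTopologicalGroup G := topologicalGroup_of_lieGroup I ∞
  let : MeasurableSpace G := borel G
  have : BorelSpace G := ⟨rfl⟩
  let μ : Measure G := Measure.haar
  let c := Module.finBasis ℝ E
  let β₀ : E → E → ℝ := fun u v => ∑ i, c.repr u i * c.repr v i
  have hc (i) : Continuous fun u => c.repr u i :=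
    ((c.coord i).continuous_of_finiteDimensional)
  have hcont (u v : E) : Continuous fun g : G => β₀ (adCLM I g⁻¹ u) (adCLM I g⁻¹ v) := by
    have h1 : Continuous fun g : G => adCLM I g⁻¹ :=
      (contMDiff_adCLM I).continuous.comp continuous_inv
    exact continuous_finsetSum _ fun i _ =>
      ((hc i).comp (h1.clm_apply continuous_const)).mul
        ((hc i).comp (h1.clm_apply continuous_const))
  have hintg (u v : E) : Integrable (fun g : G => β₀ (adCLM I g⁻¹ u) (adCLM I g⁻¹ v)) μ :=
    (hcont u v).integrable_of_hasCompactSupport (HasCompactSupport.of_compactSpace _)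
  have hpos₀ (u : E) (hu : u ≠ 0) : 0 < β₀ u u := by
    have h0 : c.repr u ≠ 0 := by simpa using hu
    obtain ⟨i, hi⟩ := Finsupp.ne_iff.1 h0
    exact Finset.sum_pos' (fun i _ => mul_self_nonneg _)
      ⟨i, Finset.mem_univ i, mul_self_pos.2 (by simpa using hi)⟩
  have hinj (g : G) (u : E) (hu : u ≠ 0) : adCLM I g⁻¹ u ≠ 0 := by
    intro h
    apply hu
    have h1 := adCLM_mul I g g⁻¹
    rw [mul_inv_cancel, adCLM_one] at h1
    have := DFunLike.congr_fun h1 u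
    simpa [h] using this
  refine ⟨LinearMap.mk₂ ℝ (fun u v => ∫ g, β₀ (adCLM I g⁻¹ u) (adCLM I g⁻¹ v) ∂μ)
    ?_ ?_ ?_ ?_, ?_, ?_, ?_⟩
  · intro u u' v
    rw [← integral_add (hintg u v) (hintg u' v)]
    congr 1; ext g
    simp [β₀, add_mul, Finset.sum_add_distrib]
  · intro r u v
    rw [smul_eq_mul, ← integral_const_mul]
    congr 1; ext g
    simp [β₀, mul_assoc, Finset.mul_sum]
  · intro u v v'
    rw [← integral_add (hintg u v) (hintg u v')]
    congr 1; ext g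
    simp [β₀, mul_add, Finset.sum_add_distrib]
  · intro r u v
    rw [smul_eq_mul, ← integral_const_mul]
    congr 1; ext g
    simp [β₀, mul_left_comm, Finset.mul_sum]
  · intro u v
    simp only [LinearMap.mk₂_apply]
    congr 1; ext g
    simp [β₀, mul_comm]
  · intro u hu
    simp only [LinearMap.mk₂_apply]
    refine (hcont u u).integral_pos_of_hasCompactSupport_nonneg_nonzero (x := 1)
      (HasCompactSupport.of_compactSpace _) (fun g => ?_) ?_
    · exact (hpos₀ _ (hinj g u hu)).le
    · exact (hpos₀ _ (hinj 1 u hu)).ne'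
  · intro x u v
    simp only [LinearMap.mk₂_apply]
    rw [← integral_mul_left_eq_self (μ := μ)
      (fun g => β₀ (adCLM I g⁻¹ (adCLM I x u)) (adCLM I g⁻¹ (adCLM I x v))) x]
    congr 1; ext g
    have : adCLM I g⁻¹ = (adCLM I (x * g)⁻¹).comp (adCLM I x) := by
      rw [← adCLM_mul]; simp
    rw [this]; rfl

lemma exists_orthogonal_basis : ∃ b : Module.Basis (Fin (Module.finrank ℝ E)) ℝ E,
    (∀ x : G, (LinearMap.toMatrix b b (adCLM I x : E →ₗ[ℝ] E)).transpose *
      LinearMap.toMatrix b b (adCLM I x : E →ₗ[ℝ] E) = 1) ∧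
    ∀ X : E, (LinearMap.toMatrix b b (dAd I G X : E →ₗ[ℝ] E)).transpose =
      -LinearMap.toMatrix b b (dAd I G X : E →ₗ[ℝ] E) := by
  obtain ⟨β, hsymm, hpos, hinv⟩ := exists_invariant_form I G
  obtain ⟨b, hb⟩ := exists_orthonormal_basis_of_posDef β hsymm hpos
  have hrepr (u : E) (i) : b.repr u i = β (b i) u := by
    conv_rhs => rw [← b.sum_repr u]
    simp only [map_sum, map_smul, hb, smul_eq_mul]
    simp
  have hβ (u v : E) : β u v = ∑ i, b.repr u i * b.repr v i := by
    conv_lhs => rw [← b.sum_repr u]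
    simp [hrepr]
  have hM (x : G) : (LinearMap.toMatrix b b (adCLM I x : E →ₗ[ℝ] E)).transpose *
      LinearMap.toMatrix b b (adCLM I x : E →ₗ[ℝ] E) = 1 := by
    ext i j
    have := hinv x (b i) (b j)
    rw [hβ, hb] at this
    simpa [Matrix.mul_apply, LinearMap.toMatrix_apply, Matrix.one_apply] using this
  refine ⟨b, hM, fun X => ?_⟩
  have hskew (u v : E) : β (dAd I G X u) v + β u (dAd I G X v) = 0 := by
    let B := LinearMap.toContinuousBilinearMap β
    let ev (u : E) : (E →L[ℝ] E) →L[ℝ] E := ContinuousLinearMap.apply ℝ E u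
    have h1 : HasFDerivAt (fun A : E →L[ℝ] E => B (ev u A) (ev v A))
        (B.precompR _ (ev u (adCLM I (1 : G))) (ev v) +
          B.precompL _ (ev u) (ev v (adCLM I (1 : G)))) (adCLM I (1 : G)) :=
      B.hasFDerivAt_of_bilinear (ev u).hasFDerivAt (ev v).hasFDerivAt
    have h2 := h1.hasMFDerivAt.comp (1 : G) (hasMFDerivAt_adCLM I (1 : G))
    have e : (fun A : E →L[ℝ] E => B (ev u A) (ev v A)) ∘ (adCLM I : G → E →L[ℝ] E) =
        fun _ => β u v := by
      ext x; exact hinv x u v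
    rw [e] at h2
    have h3 := hasMFDerivAt_unique h2 (hasMFDerivAt_const (β u v) (1 : G))
    have h4 : β (adCLM I (1 : G) u) (dAd I G X v) + β (dAd I G X u) (adCLM I (1 : G) v) = 0 :=
      DFunLike.congr_fun h3 X
    rw [adCLM_one] at h4
    simpa [add_comm] using h4
  ext i j
  have := hskew (b i) (b j)
  rw [hsymm (dAd I G X (b i)), ← hrepr, ← hrepr] at this
  simp only [Matrix.transpose_apply, LinearMap.toMatrix_apply, Matrix.neg_apply]
  exact eq_neg_of_add_eq_zero_left this

/-- The trace of the adjoint representation of a compact group is at most the dimension. -/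
lemma trCLM_adCLM_le (x : G) : trCLM E (adCLM I x) ≤ Module.finrank ℝ E := by
  obtain ⟨b, hb, -⟩ := exists_orthogonal_basis I G
  rw [trCLM_apply, LinearMap.trace_eq_matrix_trace ℝ b]
  exact trace_le_of_transpose_mul_self_eq_one _ (hb x)

lemma dAd_eq_zero_of_trace {X : E} (h : trCLM E ((dAd I G X).comp (dAd I G X)) = 0) :
    dAd I G X = 0 := by
  obtain ⟨b, -, hb⟩ := exists_orthogonal_basis I G
  rw [trCLM_apply, LinearMap.trace_eq_matrix_trace ℝ b, ContinuousLinearMap.toLinearMap_comp,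
    LinearMap.toMatrix_comp b b b] at h
  have := eq_zero_of_transpose_eq_neg _ (hb X) h
  rw [LinearEquiv.map_eq_zero_iff] at this
  ext v
  exact DFunLike.congr_fun this v

section LinearAlgebra

lemma eq_one_of_transpose_mul_self_eq_one {n : ℕ} (M : Matrix (Fin n) (Fin n) ℝ)
    (h : M.transpose * M = 1) (ht : M.trace = n) : M = 1 := by
  have h1 : ((M - 1).transpose * (M - 1)).trace = 0 := by
    simp [sub_mul, mul_sub, h, ht]
  have h2 : (M - 1).conjTranspose * (M - 1) = 0 :=
    (Matrix.posSemidef_conjTranspose_mul_self (M - 1)).trace_eq_zero_iff.1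
      (by rw [Matrix.conjTranspose_eq_transpose_of_trivial]; exact h1)
  exact sub_eq_zero.1 (Matrix.conjTranspose_mul_self_eq_zero.1 h2)

lemma trace_eq_zero_of_transpose_eq_neg {n : ℕ} (M : Matrix (Fin n) (Fin n) ℝ)
    (h : M.transpose = -M) : M.trace = 0 := by
  have h1 := congrArg Matrix.trace h
  rw [Matrix.trace_transpose, Matrix.trace_neg] at h1
  linarith

end LinearAlgebra

variable {E : Type*} [NormedAddCommGroup E] [NormedSpace ℝ E] [FiniteDimensional ℝ E]
  {H : Type*} [TopologicalSpace H] (I : ModelWithCorners ℝ E H)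
  {G : Type*} [TopologicalSpace G] [ChartedSpace H G] [Group G]

/-- The differential of the Lyapunov function at `y`, read on left-invariant fields, vanishes. -/
def IsLyapunovCritical (y : G) : Prop := ∀ Y : E, trCLM E ((adCLM I y).comp (dAd I G Y)) = 0

lemma trCLM_adCLM_of_mem_center {z : G} (hz : z ∈ Subgroup.center G) :
    trCLM E (adCLM I z) = Module.finrank ℝ E := by
  rw [adCLM_of_mem_center I hz, trCLM_apply]
  exact LinearMap.trace_id ℝ E

variable [LieGroup I ∞ G]

lemma continuous_trCLM_adCLM : Continuous fun x : G => trCLM E (adCLM I x) :=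
  (trCLM E).continuous.comp (contMDiff_adCLM I).continuous

variable [CompactSpace G]

lemma isLyapunovCritical_of_adCLM_eq_id {y : G} (hy : adCLM I y = ContinuousLinearMap.id ℝ E) :
    IsLyapunovCritical I y := by
  intro Y
  obtain ⟨b, -, hb⟩ := exists_orthogonal_basis I G
  rw [hy, ContinuousLinearMap.id_comp, trCLM_apply, LinearMap.trace_eq_matrix_trace ℝ b]
  exact trace_eq_zero_of_transpose_eq_neg _ (hb Y)

lemma isLyapunovCritical_of_eq_finrank {y : G}
    (hy : trCLM E (adCLM I y) = Module.finrank ℝ E) : IsLyapunovCritical I y := by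
  apply isLyapunovCritical_of_adCLM_eq_id
  obtain ⟨b, hb, -⟩ := exists_orthogonal_basis I G
  rw [trCLM_apply, LinearMap.trace_eq_matrix_trace ℝ b] at hy
  have h1 := eq_one_of_transpose_mul_self_eq_one _ (hb y) hy
  rw [← LinearMap.toMatrix_one b, EmbeddingLike.apply_eq_iff_eq] at h1
  ext v
  exact DFunLike.congr_fun h1 v

variable [I.Boundaryless] [LieAlgebra.HasTrivialRadical ℝ (GroupLieAlgebra I G)]

lemma eventually_eq_one_of_isLyapunovCritical :
    ∀ᶠ y in 𝓝 (1 : G), IsLyapunovCritical I y → y = 1 := by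
  let trPair : (E →L[ℝ] E) →L[ℝ] (E →L[ℝ] E) →L[ℝ] ℝ :=
    (ContinuousLinearMap.compL ℝ (E →L[ℝ] E) (E →L[ℝ] E) ℝ (trCLM E)).comp
      (ContinuousLinearMap.compL ℝ E E E)
  let C : (E →L[ℝ] E) →L[ℝ] E →L[ℝ] ℝ :=
    ((ContinuousLinearMap.compL ℝ E (E →L[ℝ] E) ℝ).flip (dAd I G)).comp trPair
  have hC (A : E →L[ℝ] E) (Y : E) : C A Y = trCLM E (A.comp (dAd I G Y)) := rfl
  have hder : HasFDerivAt (fun u => C (adCLM I ((extChartAt I (1 : G)).symm u)))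
      (C.comp (dAd I G)) (extChartAt I (1 : G) 1) :=
    C.hasFDerivAt.comp _ (hasFDerivAt_adCLM_chart_symm I)
  have hker : LinearMap.ker (C.comp (dAd I G) : E →ₗ[ℝ] E →L[ℝ] ℝ) = ⊥ := by
    rw [LinearMap.ker_eq_bot']
    intro X hX
    have h1 : trCLM E ((dAd I G X).comp (dAd I G X)) = 0 := DFunLike.congr_fun hX X
    exact eq_zero_of_dAd_eq_zero I (X := X) (dAd_eq_zero_of_trace I G h1)
  obtain ⟨K, -, hK⟩ := LinearMap.exists_antilipschitzWith _ hker
  have h1 := hder.eventually_ne (c := 0) ⟨K, hK⟩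
  rw [eventually_nhdsWithin_iff] at h1
  have h2 := (continuousAt_extChartAt (I := I) (1 : G)).eventually h1
  filter_upwards [h2, extChartAt_source_mem_nhds (I := I) (1 : G)] with y hy hys hcrit
  by_contra hne
  refine hy ?_ ?_
  · intro heq
    exact hne ((extChartAt I (1 : G)).injOn hys (mem_extChartAt_source (I := I) (1 : G)) heq)
  · rw [(extChartAt I (1 : G)).left_inv hys]
    ext Y
    exact hcrit Y

lemma eventually_eq_of_isLyapunovCritical {z : G} (hz : z ∈ Subgroup.center G) :
    ∀ᶠ y in 𝓝 z, IsLyapunovCritical I y → y = z := by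
  have : IsTopologicalGroup G := topologicalGroup_of_lieGroup I ∞
  have h1 : Filter.Tendsto (fun y : G => z⁻¹ * y) (𝓝 z) (𝓝 1) := by
    have := (continuous_const_mul z⁻¹).tendsto z
    rwa [inv_mul_cancel] at this
  filter_upwards [h1.eventually (eventually_eq_one_of_isLyapunovCritical I)] with y hy hcrit
  have h2 : z⁻¹ * y = 1 := by
    refine hy fun Y => ?_
    rw [adCLM_mul, adCLM_of_mem_center I (Subgroup.inv_mem _ hz), ContinuousLinearMap.id_comp]
    exact hcrit Y
  rwa [inv_mul_eq_one, eq_comm] at h2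

/-- A central element has a neighbourhood `U` such that every curve which starts in `U` and along
which the Lyapunov function is monotone stays in a compact set whose only critical point is `z`. -/
lemma exists_trapping_neighbourhood [T2Space G] {z : G} (hz : z ∈ Subgroup.center G) :
    ∃ K : Set G, IsCompact K ∧ (∀ y ∈ K, IsLyapunovCritical I y → y = z) ∧ ∃ U ∈ 𝓝 z,
      ∀ w : ℝ → G, Continuous w → Monotone (fun t => trCLM E (adCLM I (w t))) →
        ∀ t₀, w t₀ ∈ U → ∀ t, t₀ ≤ t → w t ∈ K := by
  obtain ⟨K, hKz, hKc, hK⟩ := exists_mem_nhds_isClosed_subset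
    (eventually_eq_of_isLyapunovCritical I hz)
  have hcomp : IsCompact K := hKc.isCompact
  have hlt : ∀ y ∈ frontier K, trCLM E (adCLM I y) < Module.finrank ℝ E := by
    intro y hy
    refine lt_of_le_of_ne (trCLM_adCLM_le I G y) fun h => ?_
    have := hK (hKc.frontier_subset hy) (isLyapunovCritical_of_eq_finrank I h)
    rw [this] at hy
    exact hy.2 (mem_interior_iff_mem_nhds.2 hKz)
  obtain ⟨c, hc, hcK⟩ : ∃ c : ℝ, c < Module.finrank ℝ E ∧
      ∀ y ∈ frontier K, trCLM E (adCLM I y) ≤ c := by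
    rcases (frontier K).eq_empty_or_nonempty with h | h
    · exact ⟨Module.finrank ℝ E - 1, by linarith, by simp [h]⟩
    · obtain ⟨y, hy, hmax⟩ := (isClosed_frontier.isCompact (s := frontier K)).exists_isMaxOn h
        (continuous_trCLM_adCLM I).continuousOn
      exact ⟨_, hlt y hy, fun x hx => hmax hx⟩
  refine ⟨K, hcomp, fun y hy => hK hy, interior K ∩ {y | c < trCLM E (adCLM I y)}, ?_, ?_⟩
  · refine Filter.inter_mem (interior_mem_nhds.2 hKz)
      ((isOpen_lt continuous_const (continuous_trCLM_adCLM I)).mem_nhds ?_)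
    simpa [trCLM_adCLM_of_mem_center I hz] using hc
  · intro w hw hmono t₀ ht₀ t ht
    have hconn : IsPreconnected (w '' Set.Icc t₀ t) := isPreconnected_Icc.image w hw.continuousOn
    have hsub : w '' Set.Icc t₀ t ⊆ interior K ∪ Kᶜ := by
      rintro _ ⟨s, hs, rfl⟩
      by_contra hcon
      rw [Set.mem_union, not_or, Set.notMem_compl_iff] at hcon
      have h1 := hcK (w s) ⟨subset_closure hcon.2, hcon.1⟩
      have h2 : trCLM E (adCLM I (w t₀)) ≤ trCLM E (adCLM I (w s)) := hmono hs.1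
      have h3 : c < trCLM E (adCLM I (w t₀)) := ht₀.2
      linarith
    have := hconn.subset_left_of_subset_union isOpen_interior hKc.isOpen_compl
      (disjoint_compl_right.mono_left interior_subset) hsub
      ⟨w t₀, ⟨t₀, Set.left_mem_Icc.2 ht, rfl⟩, ht₀.1⟩
    exact interior_subset (this ⟨t, Set.right_mem_Icc.2 ht, rfl⟩)

section Analysis

open Filter

/-- **Barbalat's lemma**: a function which is bounded above and whose derivative is nonnegative and
uniformly continuous has a derivative which tends to zero. -/
lemma tendsto_zero_of_hasDerivAt_of_uniformContinuous {v f : ℝ → ℝ} {c : ℝ}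
    (hv : ∀ t, HasDerivAt v (f t) t) (hf : ∀ t, 0 ≤ f t) (huc : UniformContinuous f)
    (hc : ∀ t, v t ≤ c) : Tendsto f atTop (𝓝 0) := by
  have hmono : Monotone v := monotone_of_hasDerivAt_nonneg hv hf
  have hlim : Tendsto v atTop (𝓝 (⨆ t, v t)) :=
    tendsto_atTop_ciSup hmono ⟨c, by rintro _ ⟨t, rfl⟩; exact hc t⟩
  rw [Metric.tendsto_atTop]
  intro ε hε
  obtain ⟨δ, hδ, hfδ⟩ := Metric.uniformContinuous_iff.1 huc (ε / 2) (by positivity)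
  have h1 : Tendsto (fun t => v (t + δ / 2) - v t) atTop (𝓝 0) := by
    have := (hlim.comp (tendsto_atTop_add_const_right _ (δ / 2) tendsto_id)).sub hlim
    simpa using this
  obtain ⟨N, hN⟩ := (h1.eventually (gt_mem_nhds (show 0 < ε / 2 * (δ / 2) by positivity)))
    |>.exists_forall_of_atTop
  refine ⟨N, fun t ht => ?_⟩
  obtain ⟨s, hs, hslope⟩ := exists_hasDerivAt_eq_slope v f (show t < t + δ / 2 by linarith)
    (fun x _ => (hv x).continuousAt.continuousWithinAt) fun x _ => hv x
  have h2 : f s < ε / 2 := by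
    rw [hslope, add_sub_cancel_left, div_lt_iff₀ (by positivity)]
    exact hN t ht
  have h3 : dist (f s) (f t) < ε / 2 := hfδ (by
    rw [Real.dist_eq, abs_lt]; constructor <;> linarith [hs.1, hs.2])
  rw [Real.dist_eq, abs_lt] at h3
  rw [Real.dist_eq, sub_zero, abs_of_nonneg (hf t)]
  linarith

lemma uniformContinuous_of_periodic {α : Type*} [UniformSpace α] {f : ℝ → α} {T : ℝ} (hT : 0 < T)
    (hp : Function.Periodic f T) (hf : Continuous f) : UniformContinuous f := by
  have : Fact (0 < T) := ⟨hT⟩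
  have h1 : Continuous (hp.lift : AddCircle T → α) := continuous_quot_lift _ hf
  have h2 : UniformContinuous (fun x : ℝ => (x : AddCircle T)) :=
    uniformContinuous_addMonoidHom_of_continuous (f := QuotientAddGroup.mk' (AddSubgroup.zmultiples T))
      (AddCircle.continuous_mk' T)
  exact (CompactSpace.uniformContinuous_of_continuous h1).comp h2

/-- Bootstrapping: a curve whose derivative is as smooth as the curve itself is smooth. -/
lemma contDiff_infty_of_hasDerivAt {F : Type*} [NormedAddCommGroup F] [NormedSpace ℝ F]
    {A A' : ℝ → F} (hA : ∀ t, HasDerivAt A (A' t) t)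
    (hboot : ∀ n : ℕ, ContDiff ℝ n A → ContDiff ℝ n A') : ContDiff ℝ ∞ A := by
  have hd : deriv A = A' := funext fun t => (hA t).deriv
  rw [contDiff_infty]
  intro n
  induction n with
  | zero => exact contDiff_zero.2 (continuous_iff_continuousAt.2 fun t => (hA t).continuousAt)
  | succ n ih =>
    have := contDiff_succ_iff_deriv (𝕜 := ℝ) (n := n) (f := A)
    refine this.2 ⟨fun t => (hA t).differentiableAt, by simp, ?_⟩
    rw [hd]
    exact hboot n ih

lemma tendsto_sub_zero_of_deriv_tendsto_zero {F : Type*} [NormedAddCommGroup F] [NormedSpace ℝ F]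
    {B B' : ℝ → F} (hB : ∀ t, HasDerivAt B (B' t) t) (h0 : Tendsto B' atTop (𝓝 0))
    {s : ℝ → ℝ} {T : ℝ} (hs : ∀ t, t ≤ s t ∧ s t ≤ t + T) :
    Tendsto (fun t => B (s t) - B t) atTop (𝓝 0) := by
  have hT : 0 ≤ T := by linarith [(hs 0).1, (hs 0).2]
  rw [Metric.tendsto_atTop] at h0 ⊢
  intro ε hε
  obtain ⟨N, hN⟩ := h0 (ε / (T + 1)) (by positivity)
  refine ⟨N, fun t ht => ?_⟩
  have h1 : ‖B (s t) - B t‖ ≤ ε / (T + 1) * ‖s t - t‖ :=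
    (convex_Ici t).norm_image_sub_le_of_norm_hasDerivWithin_le
      (fun x _ => (hB x).hasDerivWithinAt) (fun x hx => by
        have := hN x (ht.le.trans hx)
        rw [dist_zero_right] at this
        exact this.le) (Set.mem_Ici.2 le_rfl) (hs t).1
  rw [dist_zero_right]
  refine h1.trans_lt ?_
  rw [Real.norm_of_nonneg (by linarith [(hs t).1]), div_mul_eq_mul_div, div_lt_iff₀ (by positivity)]
  have : s t - t ≤ T := by linarith [(hs t).2]
  nlinarith

end Analysis

section Gradient

open Filter

variable {E : Type*} [NormedAddCommGroup E] [NormedSpace ℝ E] [FiniteDimensional ℝ E]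
  {m : ℕ} (D : E →L[ℝ] E →L[ℝ] E)

/-- Convergence to the critical set for the averaged gradient flow
`B' = B ∘ D (∑ k, tr (B ∘ D Yₖ) Yₖ)` with periodic, spanning directions `Yₖ`. -/
lemma tendsto_trace_zero {B : ℝ → E →L[ℝ] E} {Y : Fin m → ℝ → E} {T : ℝ} (hT : 0 < T)
    (hYp : ∀ k, Function.Periodic (Y k) T) (hYc : ∀ k, Continuous (Y k))
    (hspan : Submodule.span ℝ {v : E | ∃ (t : ℝ) (k : Fin m), v = Y k t} = ⊤)
    (hB : ∀ t, HasDerivAt B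
      ((B t).comp (D (∑ k, trCLM E ((B t).comp (D (Y k t))) • Y k t))) t)
    {R c : ℝ} (hBR : ∀ t, ‖B t‖ ≤ R) (hBc : ∀ t, trCLM E (B t) ≤ c) (Z : E) :
    Tendsto (fun t => trCLM E ((B t).comp (D Z))) atTop (𝓝 0) := by
  -- the data `q = (Y, B)` range in a compact set and are uniformly continuous
  let Ψa : Fin m → (Fin m → E) × (E →L[ℝ] E) → ℝ := fun k q => trCLM E (q.2.comp (D (q.1 k)))
  let Ψξ : (Fin m → E) × (E →L[ℝ] E) → E := fun q => ∑ k, Ψa k q • q.1 k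
  have hΨa (k) : Continuous (Ψa k) := by
    have h1 : Continuous fun q : (Fin m → E) × (E →L[ℝ] E) => q.1 k :=
      (continuous_apply k).comp continuous_fst
    exact (trCLM E).continuous.comp (continuous_snd.clm_comp (D.continuous.comp h1))
  have hΨξ : Continuous Ψξ := continuous_finsetSum _ fun k _ =>
    (hΨa k).smul ((continuous_apply k).comp continuous_fst)
  let q : ℝ → (Fin m → E) × (E →L[ℝ] E) := fun t => (fun k => Y k t, B t)
  have hYp' : Function.Periodic (fun t k => Y k t) T := fun t => funext fun k => hYp k t
  have hYc' : Continuous fun t k => Y k t := continuous_pi hYc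
  obtain ⟨r, hr⟩ := (hYp'.isBounded_of_continuous hT.ne' hYc').subset_closedBall 0
  have : ProperSpace (E →L[ℝ] E) := FiniteDimensional.proper ℝ _
  have : ProperSpace E := FiniteDimensional.proper ℝ _
  let K : Set ((Fin m → E) × (E →L[ℝ] E)) := Metric.closedBall 0 r ×ˢ Metric.closedBall 0 R
  have hK : IsCompact K := (isCompact_closedBall _ _).prod (isCompact_closedBall _ _)
  have hqK (t) : q t ∈ K := ⟨hr ⟨t, rfl⟩, by simpa using hBR t⟩
  have huc {Ψ : (Fin m → E) × (E →L[ℝ] E) → ℝ} (hΨ : Continuous Ψ)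
      (hq : UniformContinuous q) : UniformContinuous fun t => Ψ (q t) := by
    have h1 := hK.uniformContinuousOn_of_continuous hΨ.continuousOn
    rw [← uniformContinuousOn_univ] at hq ⊢
    exact h1.comp hq fun t _ => hqK t
  have hqB (t) : HasDerivAt B ((q t).2.comp (D (Ψξ (q t)))) t := hB t
  have hΨB : Continuous fun q : (Fin m → E) × (E →L[ℝ] E) => q.2.comp (D (Ψξ q)) :=
    continuous_snd.clm_comp (D.continuous.comp hΨξ)
  have hBuc : UniformContinuous B := by
    obtain ⟨L, hL⟩ := (hK.image hΨB).isBounded.subset_closedBall 0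
    have : LipschitzWith L.toNNReal B := lipschitzWith_of_nnnorm_deriv_le
      (fun t => (hqB t).differentiableAt) fun t => by
        rw [(hqB t).deriv, ← NNReal.coe_le_coe, coe_nnnorm]
        have := hL ⟨q t, hqK t, rfl⟩
        rw [mem_closedBall_zero_iff] at this
        exact this.trans (Real.le_coe_toNNReal L)
    exact this.uniformContinuous
  have hquc : UniformContinuous q := (uniformContinuous_of_periodic hT hYp' hYc').prodMk hBuc
  -- the derivative of the trace
  have hv (t) : HasDerivAt (fun t => trCLM E (B t)) (∑ k, Ψa k (q t) ^ 2) t := by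
    have h1 := (trCLM E).hasFDerivAt.comp_hasDerivAt t (hB t)
    refine h1.congr_deriv ?_
    have h2 (Z : E) : trCLM E ((B t).comp (D Z)) = (((trCLM E).comp
      (ContinuousLinearMap.compL ℝ E E E (B t))).comp D) Z := rfl
    rw [h2, map_sum]
    refine Finset.sum_congr rfl fun k _ => ?_
    rw [map_smul, ← h2, smul_eq_mul, sq]
  have hf0 : Tendsto (fun t => ∑ k, Ψa k (q t) ^ 2) atTop (𝓝 0) :=
    tendsto_zero_of_hasDerivAt_of_uniformContinuous hv
      (fun t => Finset.sum_nonneg fun k _ => sq_nonneg _)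
      (huc (continuous_finsetSum _ fun k _ => (hΨa k).pow 2) hquc) hBc
  have ha0 (k) : Tendsto (fun t => Ψa k (q t)) atTop (𝓝 0) := by
    have h1 : Tendsto (fun t => Ψa k (q t) ^ 2) atTop (𝓝 0) :=
      squeeze_zero (fun t => sq_nonneg _) (fun t => Finset.single_le_sum
        (f := fun k => Ψa k (q t) ^ 2) (fun k _ => sq_nonneg _) (Finset.mem_univ k)) hf0
    have h2 := h1.sqrt
    simp only [Real.sqrt_sq_eq_abs, Real.sqrt_zero] at h2
    exact (tendsto_zero_iff_abs_tendsto_zero _).2 h2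
  have hB0 : Tendsto (fun t => (q t).2.comp (D (Ψξ (q t)))) atTop (𝓝 0) := by
    have h1 (k) : Tendsto (fun t => Ψa k (q t) • (q t).1 k) atTop (𝓝 0) := by
      refine NormedField.tendsto_zero_smul_of_tendsto_zero_of_bounded (ha0 k) ?_
      refine isBoundedUnder_of ⟨r, fun t => ?_⟩
      have := (hqK t).1
      rw [mem_closedBall_zero_iff] at this
      exact (norm_le_pi_norm _ k).trans this
    have h2 : Tendsto (fun t => Ψξ (q t)) atTop (𝓝 0) := by
      simpa using tendsto_finsetSum Finset.univ fun k _ => h1 k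
    have h3 : Tendsto (fun t => ‖D‖ * ‖Ψξ (q t)‖ * R) atTop (𝓝 0) := by
      simpa using (h2.norm.const_mul ‖D‖).mul_const R
    refine squeeze_zero_norm (fun t => ?_) h3
    calc ‖(B t).comp (D (Ψξ (q t)))‖ ≤ ‖B t‖ * ‖D (Ψξ (q t))‖ :=
          ContinuousLinearMap.opNorm_comp_le _ _
      _ ≤ R * (‖D‖ * ‖Ψξ (q t)‖) := mul_le_mul (hBR t) (D.le_opNorm _) (norm_nonneg _)
          ((norm_nonneg _).trans (hBR t))
      _ = _ := by ring
  have hmem : Z ∈ Submodule.span ℝ {v : E | ∃ (t : ℝ) (k : Fin m), v = Y k t} := by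
    rw [hspan]; trivial
  induction hmem using Submodule.span_induction with
  | mem Z hZ =>
    obtain ⟨σ, k, rfl⟩ := hZ
    let s : ℝ → ℝ := fun t => toIcoMod hT t σ
    have hs (t) : t ≤ s t ∧ s t ≤ t + T :=
      ⟨left_le_toIcoMod hT t σ, (toIcoMod_lt_right hT t σ).le⟩
    have hYs (t) : Y k (s t) = Y k σ := (hYp k).sub_zsmul_eq _
    have hs' : Tendsto s atTop atTop := tendsto_atTop_mono (fun t => (hs t).1) tendsto_id
    have h1 := tendsto_sub_zero_of_deriv_tendsto_zero hqB hB0 hs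
    have h2 : Tendsto (fun t => trCLM E ((B (s t) - B t).comp (D (Y k σ)))) atTop (𝓝 0) := by
      have h3 : Continuous fun A : E →L[ℝ] E => trCLM E (A.comp (D (Y k σ))) :=
        (trCLM E).continuous.comp (continuous_id.clm_comp continuous_const)
      have h5 := (h3.tendsto 0).comp h1
      rw [ContinuousLinearMap.zero_comp, map_zero] at h5
      exact h5
    have h4 := ((ha0 k).comp hs').sub h2
    rw [sub_zero] at h4
    refine h4.congr fun t => ?_
    simp only [Function.comp_apply, Ψa, q, hYs, ContinuousLinearMap.sub_comp, map_sub]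
    ring
  | zero => simp
  | add x y _ _ hx hy => simpa [ContinuousLinearMap.comp_add] using hx.add hy
  | smul a x _ hx => simpa [ContinuousLinearMap.comp_smul] using hx.const_mul a

end Gradient

section UniformExistence

open Set Function

variable {E : Type*} [NormedAddCommGroup E] [NormedSpace ℝ E]
  {H : Type*} [TopologicalSpace H] {I : ModelWithCorners ℝ E H}
  {M : Type*} [TopologicalSpace M] [ChartedSpace H M] [IsManifold I 1 M]

/-- A `C¹` vector field on a vector space has, near each point, integral curves defined on a
uniform time interval and staying in a prescribed neighbourhood. -/
lemma exists_uniform_time_of_contDiffAt [CompleteSpace E] {f : E → E} {x₀ : E}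
    (hf : ContDiffAt ℝ 1 f x₀) {s : Set E} (hs : s ∈ 𝓝 x₀) :
    ∃ u ∈ 𝓝 x₀, ∃ ε > (0 : ℝ), ∀ x ∈ u, ∃ α : ℝ → E, α 0 = x ∧
      ∀ t ∈ Ioo (-ε) ε, HasDerivAt α (f (α t)) t ∧ α t ∈ s := by
  obtain ⟨ε, hε, a, r, L, K, hr, hpl⟩ := IsPicardLindelof.of_contDiffAt_one hf
  obtain ⟨α, hα, hcont⟩ :=
    (hpl 0).exists_forall_mem_closedBall_eq_hasDerivWithinAt_continuousOn
  have hball : Metric.closedBall x₀ (r : ℝ) ∈ 𝓝 x₀ :=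
    Metric.closedBall_mem_nhds x₀ (by simpa using hr)
  have hIcc : Icc (0 - ε) (0 + ε) ∈ 𝓝 (0 : ℝ) := Icc_mem_nhds (by linarith) (by linarith)
  have hca : ContinuousAt α (x₀, 0) := hcont.continuousAt (prod_mem_nhds hball hIcc)
  have h0 : α (x₀, 0) = x₀ := (hα x₀ (mem_of_mem_nhds hball)).1
  have hpre : α ⁻¹' s ∈ 𝓝 (x₀, (0 : ℝ)) := hca.preimage_mem_nhds (by rwa [h0])
  rw [nhds_prod_eq, Filter.mem_prod_iff] at hpre
  obtain ⟨u, hu, v, hv, huv⟩ := hpre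
  obtain ⟨δ, hδ, hδv⟩ := Metric.mem_nhds_iff.1 hv
  refine ⟨u ∩ Metric.closedBall x₀ r, Filter.inter_mem hu hball, min ε δ, lt_min hε hδ,
    fun x hx => ⟨fun t => α (x, t), (hα x hx.2).1, fun t ht => ?_⟩⟩
  have h1 : -ε < t ∧ t < ε :=
    ⟨lt_of_le_of_lt (neg_le_neg (min_le_left _ _)) ht.1, lt_of_lt_of_le ht.2 (min_le_left _ _)⟩
  have h2 : |t| < δ := lt_of_lt_of_le (abs_lt.2 ht) (min_le_right _ _)
  refine ⟨?_, huv (show (x, t) ∈ u ×ˢ v from ⟨hx.1, hδv (by simpa using h2)⟩)⟩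
  exact ((hα x hx.2).2 t ⟨by linarith, by linarith⟩).hasDerivAt
    (Icc_mem_nhds (by linarith) (by linarith))

/-- A `C¹` vector field on a manifold without boundary has, near each point, integral curves defined
on a uniform time interval. -/
lemma exists_uniform_time_isMIntegralCurveOn [CompleteSpace E] [BoundarylessManifold I M]
    {v : (x : M) → TangentSpace I x} {x₀ : M}
    (hv : ContMDiffAt I I.tangent 1 (fun x => (⟨x, v x⟩ : TangentBundle I M)) x₀) :
    ∃ u ∈ 𝓝 x₀, ∃ ε > (0 : ℝ), ∀ x ∈ u, ∃ γ : ℝ → M, γ 0 = x ∧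
      IsMIntegralCurveOn γ v (Ioo (-ε) ε) := by
  have hx : I.IsInteriorPoint x₀ := BoundarylessManifold.isInteriorPoint
  rw [contMDiffAt_iff] at hv
  obtain ⟨_, hv⟩ := hv
  have hintg : interior (extChartAt I x₀).target ∈ 𝓝 (extChartAt I x₀ x₀) :=
    isOpen_interior.mem_nhds (I.isInteriorPoint_iff.1 hx)
  obtain ⟨u, hu, ε, hε, H⟩ := exists_uniform_time_of_contDiffAt
    (hv.contDiffAt (range_mem_nhds_isInteriorPoint hx)).snd hintg
  refine ⟨extChartAt I x₀ ⁻¹' u ∩ (extChartAt I x₀).source, Filter.inter_mem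
    ((continuousAt_extChartAt x₀).preimage_mem_nhds hu) (extChartAt_source_mem_nhds x₀), ε, hε,
    fun x hxu => ?_⟩
  obtain ⟨f, hf0, hf⟩ := H _ hxu.1
  refine ⟨(extChartAt I x₀).symm ∘ f,
    by rw [Function.comp_apply, hf0, PartialEquiv.left_inv _ hxu.2], ?_⟩
  intro t ht
  let xₜ : M := (extChartAt I x₀).symm (f t)
  have h : HasDerivAt f (x := t) <| fderivWithin ℝ (extChartAt I x₀ ∘ (extChartAt I xₜ).symm)
    (range I) (extChartAt I xₜ xₜ) (v xₜ) := (hf t ht).1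
  rw [← tangentCoordChange_def] at h
  have hf3 := (hf t ht).2
  have hf3' := mem_of_mem_of_subset hf3 interior_subset
  have hft1 := mem_preimage.mp <|
    mem_of_mem_of_subset hf3' (extChartAt I x₀).target_subset_preimage_source
  have hft2 := mem_extChartAt_source (I := I) xₜ
  let vₜ : E := v xₜ
  have hmain : HasDerivAt ((extChartAt I xₜ ∘ (extChartAt I x₀).symm) ∘ f) vₜ t := by
    rw [← tangentCoordChange_self (I := I) (x := xₜ) (z := xₜ) (v := vₜ) hft2,
      ← tangentCoordChange_comp (x := x₀) ⟨⟨hft2, hft1⟩, hft2⟩]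
    refine HasFDerivAt.comp_hasDerivAt t ?_ h
    refine HasFDerivWithinAt.hasFDerivAt (s := range I) ?_ <|
      mem_nhds_iff.mpr ⟨interior (extChartAt I x₀).target,
        subset_trans interior_subset (extChartAt_target_subset_range ..),
        isOpen_interior, hf3⟩
    rw [← (extChartAt I x₀).right_inv hf3']
    exact hasFDerivWithinAt_tangentCoordChange ⟨hft1, hft2⟩
  apply HasMFDerivAt.hasMFDerivWithinAt
  exact ⟨(continuousAt_extChartAt_symm'' hf3').comp h.continuousAt,
    hmain.hasFDerivAt.hasFDerivWithinAt⟩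

end UniformExistence

section Suspension

open Set Function

lemma smulRight_prod_smulRight {E : Type*} [NormedAddCommGroup E] [NormedSpace ℝ E] (a : ℝ) (y : E) :
    ((1 : ℝ →L[ℝ] ℝ).smulRight a).prod ((1 : ℝ →L[ℝ] ℝ).smulRight y) =
      (1 : ℝ →L[ℝ] ℝ).smulRight (a, y) := by
  ext <;> simp

lemma fst_comp_smulRight {E : Type*} [NormedAddCommGroup E] [NormedSpace ℝ E] (a : ℝ) (y : E) :
    (ContinuousLinearMap.fst ℝ ℝ E).comp ((1 : ℝ →L[ℝ] ℝ).smulRight (a, y)) =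
      (1 : ℝ →L[ℝ] ℝ).smulRight a := by
  ext; simp

lemma snd_comp_smulRight {E : Type*} [NormedAddCommGroup E] [NormedSpace ℝ E] (a : ℝ) (y : E) :
    (ContinuousLinearMap.snd ℝ ℝ E).comp ((1 : ℝ →L[ℝ] ℝ).smulRight (a, y)) =
      (1 : ℝ →L[ℝ] ℝ).smulRight y := by
  ext; simp

variable {E : Type*} [NormedAddCommGroup E] [NormedSpace ℝ E]
  {H : Type*} [TopologicalSpace H] (I : ModelWithCorners ℝ E H)
  {G : Type*} [TopologicalSpace G] [ChartedSpace H G]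

/-- The autonomous vector field `(1, Y)` on `ℝ × G` attached to a time-dependent field `Y`. -/
def suspension (Y : ℝ → (x : G) → TangentSpace I x) (p : ℝ × G) :
    TangentSpace (𝓘(ℝ, ℝ).prod I) p :=
  ((1 : ℝ), (Y p.1 p.2 : E))

variable {I}

lemma hasMFDerivWithinAt_suspension {Y : ℝ → (x : G) → TangentSpace I x} {θ : ℝ → ℝ} {w : ℝ → G}
    {s : Set ℝ} {t : ℝ} (hθ : HasDerivWithinAt θ 1 s t)
    (hw : HasMFDerivWithinAt 𝓘(ℝ, ℝ) I w s t
      ((1 : ℝ →L[ℝ] ℝ).smulRight (Y (θ t) (w t) : E) : ℝ →L[ℝ] E)) :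
    HasMFDerivWithinAt 𝓘(ℝ, ℝ) (𝓘(ℝ, ℝ).prod I) (fun t => (θ t, w t)) s t
      ((1 : ℝ →L[ℝ] ℝ).smulRight (suspension I Y (θ t, w t) : ℝ × E) : ℝ →L[ℝ] ℝ × E) := by
  have h1 : HasMFDerivWithinAt 𝓘(ℝ, ℝ) 𝓘(ℝ, ℝ) θ s t ((1 : ℝ →L[ℝ] ℝ).smulRight (1 : ℝ)) :=
    hθ.hasFDerivWithinAt.hasMFDerivWithinAt
  exact (h1.prodMk hw).congr_mfderiv (smulRight_prod_smulRight (E := E) 1 (Y (θ t) (w t) : E))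

lemma hasDerivWithinAt_fst_of_suspension {Y : ℝ → (x : G) → TangentSpace I x} {γ : ℝ → ℝ × G}
    {s : Set ℝ} {t : ℝ} (h : HasMFDerivWithinAt 𝓘(ℝ, ℝ) (𝓘(ℝ, ℝ).prod I) γ s t
      ((1 : ℝ →L[ℝ] ℝ).smulRight (suspension I Y (γ t) : ℝ × E) : ℝ →L[ℝ] ℝ × E)) :
    HasDerivWithinAt (fun t => (γ t).1) 1 s t := by
  have h1 : HasMFDerivWithinAt 𝓘(ℝ, ℝ) 𝓘(ℝ, ℝ) (fun t => (γ t).1) s t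
      ((ContinuousLinearMap.fst ℝ ℝ E).comp ((1 : ℝ →L[ℝ] ℝ).smulRight
        (suspension I Y (γ t) : ℝ × E) : ℝ →L[ℝ] ℝ × E) : ℝ →L[ℝ] ℝ) :=
    (hasMFDerivAt_fst (γ t)).comp_hasMFDerivWithinAt t h
  have h2 : HasFDerivWithinAt (fun t => (γ t).1) ((1 : ℝ →L[ℝ] ℝ).smulRight (1 : ℝ)) s t :=
    (h1.congr_mfderiv (fst_comp_smulRight (E := E) 1 (Y (γ t).1 (γ t).2 : E))).hasFDerivWithinAt
  simpa using h2.hasDerivWithinAt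

lemma hasMFDerivWithinAt_snd_of_suspension {Y : ℝ → (x : G) → TangentSpace I x} {γ : ℝ → ℝ × G}
    {s : Set ℝ} {t : ℝ} (h : HasMFDerivWithinAt 𝓘(ℝ, ℝ) (𝓘(ℝ, ℝ).prod I) γ s t
      ((1 : ℝ →L[ℝ] ℝ).smulRight (suspension I Y (γ t) : ℝ × E) : ℝ →L[ℝ] ℝ × E)) :
    HasMFDerivWithinAt 𝓘(ℝ, ℝ) I (fun t => (γ t).2) s t
      ((1 : ℝ →L[ℝ] ℝ).smulRight (Y (γ t).1 (γ t).2 : E) : ℝ →L[ℝ] E) := by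
  have h1 : HasMFDerivWithinAt 𝓘(ℝ, ℝ) I (fun t => (γ t).2) s t
      ((ContinuousLinearMap.snd ℝ ℝ E).comp ((1 : ℝ →L[ℝ] ℝ).smulRight
        (suspension I Y (γ t) : ℝ × E) : ℝ →L[ℝ] ℝ × E) : ℝ →L[ℝ] E) :=
    (hasMFDerivAt_snd (γ t)).comp_hasMFDerivWithinAt t h
  exact h1.congr_mfderiv (snd_comp_smulRight (E := E) 1 (Y (γ t).1 (γ t).2 : E))

variable [I.Boundaryless] [IsManifold I 1 G] [T2Space G]

lemma eq_of_isIntegralCurve {Y : ℝ → (x : G) → TangentSpace I x}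
    (hY : ContMDiff (𝓘(ℝ, ℝ).prod I) (𝓘(ℝ, ℝ).prod I).tangent 1
      (fun p => (⟨p, suspension I Y p⟩ : TangentBundle (𝓘(ℝ, ℝ).prod I) (ℝ × G))))
    {w w' : ℝ → G} (hw : IsIntegralCurve I Y w) (hw' : IsIntegralCurve I Y w') {t₀ : ℝ}
    (h : w t₀ = w' t₀) : w = w' := by
  have key {w : ℝ → G} (hw : IsIntegralCurve I Y w) :
      IsMIntegralCurve (fun t => (t, w t)) (suspension I Y) := by
    intro t
    exact (hasMFDerivWithinAt_suspension (s := univ) (θ := fun t => t) (hasDerivWithinAt_id t univ)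
      (hw t).hasMFDerivWithinAt).hasMFDerivAt Filter.univ_mem
  have := isMIntegralCurve_Ioo_eq_of_contMDiff_boundaryless (t₀ := t₀) hY (key hw) (key hw')
    (by simp [h])
  funext t
  exact congrArg Prod.snd (congrFun this t)

/-- Global existence for a time-periodic field on a compact manifold. -/
lemma exists_isIntegralCurve [FiniteDimensional ℝ E] [CompactSpace G]
    {Y : ℝ → (x : G) → TangentSpace I x}
    (hY : ContMDiff (𝓘(ℝ, ℝ).prod I) (𝓘(ℝ, ℝ).prod I).tangent 1
      (fun p => (⟨p, suspension I Y p⟩ : TangentBundle (𝓘(ℝ, ℝ).prod I) (ℝ × G))))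
    {T : ℝ} (hT : 0 < T) (hper : ∀ t, Y (t + T) = Y t) (t₀ : ℝ) (x₀ : G) :
    ∃ w : ℝ → G, IsIntegralCurve I Y w ∧ w t₀ = x₀ := by
  let P (ε : ℝ) (p : ℝ × G) : Prop := ∃ γ : ℝ → ℝ × G, γ 0 = p ∧
    IsMIntegralCurveOn γ (suspension I Y) (Ioo (-ε) ε)
  have hPmono {ε ε' : ℝ} (h : ε ≤ ε') {p : ℝ × G} (hp : P ε' p) : P ε p := by
    obtain ⟨γ, h0, hγ⟩ := hp
    exact ⟨γ, h0, hγ.mono (Ioo_subset_Ioo (neg_le_neg h) h)⟩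
  obtain ⟨ε, hε, hK⟩ : ∃ ε > 0, ∀ p ∈ Icc 0 T ×ˢ (univ : Set G), P ε p := by
    refine (isCompact_Icc.prod isCompact_univ).induction_on
      (p := fun s => ∃ ε > 0, ∀ p ∈ s, P ε p) ⟨1, one_pos, by simp⟩ ?_ ?_ ?_
    · rintro s t hst ⟨ε, hε, h⟩
      exact ⟨ε, hε, fun p hp => h p (hst hp)⟩
    · rintro s t ⟨ε, hε, h⟩ ⟨ε', hε', h'⟩
      refine ⟨min ε ε', lt_min hε hε', fun p hp => hp.elim (fun hp => ?_) fun hp => ?_⟩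
      · exact hPmono (min_le_left _ _) (h p hp)
      · exact hPmono (min_le_right _ _) (h' p hp)
    · intro p _
      obtain ⟨u, hu, ε, hε, h⟩ := exists_uniform_time_isMIntegralCurveOn (hY p)
      exact ⟨u, mem_nhdsWithin_of_mem_nhds hu, ε, hε, h⟩
  have hYp : Function.Periodic Y T := hper
  have hall (p : ℝ × G) : P ε p := by
    let c : ℝ := toIcoDiv hT 0 p.1 • T
    have hc : (p.1 - c, p.2) ∈ Icc 0 T ×ˢ (univ : Set G) := by
      have := toIcoMod_mem_Ico hT 0 p.1
      rw [zero_add] at this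
      exact ⟨⟨this.1, this.2.le⟩, trivial⟩
    obtain ⟨γ, h0, hγ⟩ := hK _ hc
    refine ⟨fun s => ((γ s).1 + c, (γ s).2), by simp [h0], fun t ht => ?_⟩
    have h1 := hasDerivWithinAt_fst_of_suspension (hγ t ht)
    have h2 := hasMFDerivWithinAt_snd_of_suspension (hγ t ht)
    refine hasMFDerivWithinAt_suspension (θ := fun s => (γ s).1 + c) (h1.add_const c) ?_
    have e : Y ((γ t).1 + c) = Y (γ t).1 := hYp.zsmul _ _
    rw [e]
    exact h2
  obtain ⟨γ, h0, hγ⟩ := exists_isMIntegralCurve_of_isMIntegralCurveOn hY hε hall (t₀, x₀)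
  have hfst (s : ℝ) : (γ s).1 = t₀ + s := by
    have hd (s : ℝ) : HasDerivAt (fun s => (γ s).1 - s) 0 s := by
      have := hasDerivWithinAt_fst_of_suspension (hγ s).hasMFDerivWithinAt (s := univ)
      exact ((this.hasDerivAt Filter.univ_mem).sub (hasDerivAt_id s)).congr_deriv (sub_self 1)
    have := is_const_of_deriv_eq_zero (fun s => (hd s).differentiableAt)
      (fun s => (hd s).deriv) s 0
    simp only [h0, sub_zero] at this
    linarith
  refine ⟨fun t => (γ (t - t₀)).2, fun t => ?_, by simp [h0]⟩
  have h1 := (hasMFDerivWithinAt_snd_of_suspension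
    ((hγ (t - t₀)).hasMFDerivWithinAt (s := univ))).hasMFDerivAt Filter.univ_mem
  have h2 : HasMFDerivAt 𝓘(ℝ, ℝ) 𝓘(ℝ, ℝ) (fun t : ℝ => t - t₀) t
      (ContinuousLinearMap.id ℝ ℝ : ℝ →L[ℝ] ℝ) :=
    ((hasFDerivAt_id t).sub_const t₀).hasMFDerivAt
  have e : Y (γ (t - t₀)).1 = Y t := by rw [hfst, add_sub_cancel]
  rw [e] at h1
  exact h1.comp t h2

end Suspension

section LeftTranslation

variable {E : Type*} [NormedAddCommGroup E] [NormedSpace ℝ E]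
  {H : Type*} [TopologicalSpace H] (I : ModelWithCorners ℝ E H)
  {G : Type*} [TopologicalSpace G] [ChartedSpace H G]

lemma contMDiff_tangentBundle_const_proj [IsManifold I 1 G] {E' : Type*} [NormedAddCommGroup E']
    [NormedSpace ℝ E'] {H' : Type*} [TopologicalSpace H'] {I' : ModelWithCorners ℝ E' H'}
    {N : Type*} [TopologicalSpace N] [ChartedSpace H' N] (x : G) {ξ : N → E}
    (hξ : ContMDiff I' 𝓘(ℝ, E) 1 ξ) :
    ContMDiff I' I.tangent 1 (fun p => (⟨x, ξ p⟩ : TangentBundle I G)) := by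
  intro p
  rw [Bundle.contMDiffAt_totalSpace]
  refine ⟨contMDiffAt_const, (hξ p).congr_of_eventuallyEq (Filter.Eventually.of_forall fun q => ?_)⟩
  exact tangentCoordChange_self (I := I) (mem_extChartAt_source (I := I) x)

lemma tangentBundle_mk_congr {a b : G} (h : a = b) (v : E) :
    (⟨a, v⟩ : TangentBundle I G) = ⟨b, v⟩ := by subst h; rfl

variable [Group G] [LieGroup I ∞ G]

lemma contMDiff_leftCLM {E' : Type*} [NormedAddCommGroup E']
    [NormedSpace ℝ E'] {H' : Type*} [TopologicalSpace H'] {I' : ModelWithCorners ℝ E' H'}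
    {N : Type*} [TopologicalSpace N] [ChartedSpace H' N] {g : N → G} {ξ : N → E}
    (hg : ContMDiff I' I 1 g) (hξ : ContMDiff I' 𝓘(ℝ, E) 1 ξ) :
    ContMDiff I' I.tangent 1 (fun p => (⟨g p, leftCLM I (g p) (ξ p)⟩ : TangentBundle I G)) := by
  have s1 : ContMDiff I' I.tangent 1 (fun p => (⟨g p, (0 : E)⟩ : TangentBundle I G)) :=
    (Bundle.contMDiff_zeroSection ℝ (TangentSpace I : G → Type _)).comp hg
  have s2 := contMDiff_tangentBundle_const_proj I (1 : G) hξ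
  have s3 : ContMDiff (I.tangent.prod I.tangent) (I.prod I).tangent 1
      (equivTangentBundleProd I G I G).symm := contMDiff_equivTangentBundleProd_symm
  have s4 : ContMDiff (I.prod I).tangent I.tangent 1
      (tangentMap (I.prod I) I (fun p : G × G => p.1 * p.2)) :=
    ContMDiff.contMDiff_tangentMap (n := ∞) (contMDiff_mul I ∞)
      (by rw [one_add_one_eq_two]; exact ENat.LEInfty.out)
  have s5 := s4.comp (s3.comp (s1.prodMk s2))
  refine s5.congr fun p => ?_
  let Dm : E × E →L[ℝ] E := mfderiv (I.prod I) I (fun p : G × G => p.1 * p.2) (g p, 1)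
  have h1 : HasMFDerivAt (I.prod I) I (fun p : G × G => p.1 * p.2) (g p, 1)
      (Dm : E × E →L[ℝ] E) :=
    ((contMDiff_mul I ∞).mdifferentiable (by simp) (g p, 1)).hasMFDerivAt
  have h2 : HasMFDerivAt I (I.prod I) (fun y : G => (g p, y)) (1 : G)
      ((0 : E →L[ℝ] E).prod (ContinuousLinearMap.id ℝ E) : E →L[ℝ] E × E) :=
    (hasMFDerivAt_const (g p) (1 : G)).prodMk (hasMFDerivAt_id (1 : G))
  have h3 : Dm.comp ((0 : E →L[ℝ] E).prod (ContinuousLinearMap.id ℝ E)) = leftCLM I (g p) :=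
    hasMFDerivAt_unique (h1.comp (1 : G) h2) (hasMFDerivAt_mul_left I (g p))
  have h4 : leftCLM I (g p) (ξ p) = Dm (0, ξ p) := by rw [← h3]; rfl
  rw [h4]
  exact tangentBundle_mk_congr I (mul_one (g p)).symm (Dm (0, ξ p))

lemma contMDiff_suspension_leftCLM {ξ : ℝ × G → E}
    (hξ : ContMDiff (𝓘(ℝ, ℝ).prod I) 𝓘(ℝ, E) 1 ξ) :
    ContMDiff (𝓘(ℝ, ℝ).prod I) (𝓘(ℝ, ℝ).prod I).tangent 1
      (fun p => (⟨p, suspension I (fun t w => leftCLM I w (ξ (t, w))) p⟩ :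
        TangentBundle (𝓘(ℝ, ℝ).prod I) (ℝ × G))) := by
  have s1 : ContMDiff 𝓘(ℝ, ℝ) 𝓘(ℝ, ℝ).tangent 1
      (fun t : ℝ => (⟨t, (1 : ℝ)⟩ : TangentBundle 𝓘(ℝ, ℝ) ℝ)) :=
    contMDiff_vectorSpace_iff_contDiff.2 contDiff_const
  have s2 := s1.comp (contMDiff_fst (I := 𝓘(ℝ, ℝ)) (J := I) (M := ℝ) (N := G))
  have s3 := contMDiff_leftCLM I (contMDiff_snd (I := 𝓘(ℝ, ℝ)) (J := I) (M := ℝ) (N := G)) hξ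
  have s4 : ContMDiff (𝓘(ℝ, ℝ).tangent.prod I.tangent) (𝓘(ℝ, ℝ).prod I).tangent 1
      (equivTangentBundleProd 𝓘(ℝ, ℝ) ℝ I G).symm := contMDiff_equivTangentBundleProd_symm
  exact s4.comp (s2.prodMk s3)

end LeftTranslation

section Tracking

open Filter

variable {E : Type*} [NormedAddCommGroup E] [NormedSpace ℝ E]
  {H : Type*} [TopologicalSpace H] (I : ModelWithCorners ℝ E H)
  {G : Type*} [TopologicalSpace G] [ChartedSpace H G] [Group G] {m : ℕ} (X : Fin m → GroupLieAlgebra I G)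

lemma IsTrajectory.hasMFDerivAt {x : ℝ → G} {u : Fin m → ℝ → ℝ} (h : IsTrajectory I X x u)
    (t : ℝ) : HasMFDerivAt 𝓘(ℝ, ℝ) I x t
      ((1 : ℝ →L[ℝ] ℝ).smulRight (leftCLM I (x t) (∑ k, u k t • (X k : E))) : ℝ →L[ℝ] E) := by
  have e (L : E →L[ℝ] E) (v : Fin m → E) : ∑ k, u k t • L (v k) = L (∑ k, u k t • v k) := by
    simp [map_sum]
  refine (h.integralCurve t).congr_mfderiv ?_
  exact congrArg (fun v : E => (1 : ℝ →L[ℝ] ℝ).smulRight v) (e (leftCLM I (x t)) X)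

lemma auxField_periodic {xr : ℝ → G} {T : ℝ} (h : Function.Periodic xr T) (t : ℝ) :
    auxField I X xr (t + T) = auxField I X xr t := by
  funext w
  simp only [auxField, auxCoeff, h t]

section Auxiliary

variable [FiniteDimensional ℝ E]

/-- The field `W` pulled back to the Lie algebra by left translation, for the directions
`Yₖ = Ad (xr t) Xₖ`. -/
def auxVec (xr : ℝ → G) (t : ℝ) (B : E →L[ℝ] E) : E :=
  ∑ k, trCLM E (B.comp (dAd I G (adCLM I (xr t) (X k : E)))) • adCLM I (xr t) (X k : E)

lemma contDiff_auxCoeff_comp {xr : ℝ → G} {B : ℝ → E →L[ℝ] E} {n : ℕ∞ω}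
    (hx : ContDiff ℝ n (fun t => adCLM I (xr t))) (hB : ContDiff ℝ n B) (k : Fin m) :
    ContDiff ℝ n
      (fun t => trCLM E ((B t).comp (dAd I G (adCLM I (xr t) (X k : E))))) :=
  (trCLM E).contDiff.comp
    (hB.clm_comp ((dAd I G).contDiff.comp (hx.clm_apply contDiff_const)))

lemma contDiff_auxVec_comp {xr : ℝ → G} {B : ℝ → E →L[ℝ] E} {n : ℕ∞ω}
    (hx : ContDiff ℝ n (fun t => adCLM I (xr t))) (hB : ContDiff ℝ n B) :
    ContDiff ℝ n (fun t => auxVec I X xr t (B t)) :=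
  ContDiff.sum fun k _ => (contDiff_auxCoeff_comp I X hx hB k).smul (hx.clm_apply contDiff_const)

lemma contDiff_auxVec {xr : ℝ → G} (hx : ContDiff ℝ ∞ (fun t => adCLM I (xr t))) :
    ContDiff ℝ 1 (fun q : ℝ × (E →L[ℝ] E) => auxVec I X xr q.1 q.2) := by
  have hx' : ContDiff ℝ 1 (fun q : ℝ × (E →L[ℝ] E) => adCLM I (xr q.1)) :=
    (hx.of_le (by exact_mod_cast le_top)).comp contDiff_fst
  have hY (k : Fin m) : ContDiff ℝ 1 (fun q : ℝ × (E →L[ℝ] E) => adCLM I (xr q.1) (X k : E)) :=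
    hx'.clm_apply contDiff_const
  have hD (k : Fin m) : ContDiff ℝ 1
      (fun q : ℝ × (E →L[ℝ] E) => q.2.comp (dAd I G (adCLM I (xr q.1) (X k : E)))) :=
    contDiff_snd.clm_comp ((dAd I G).contDiff.comp (hY k))
  exact ContDiff.sum fun k _ => ((trCLM E).contDiff.comp (hD k)).smul (hY k)

end Auxiliary

variable [LieGroup I ∞ G]

lemma mfderiv_mul_apply (w x : G) (η ξ : E) :
    (mfderiv (I.prod I) I (fun p : G × G => p.1 * p.2) (w, x) : E × E →L[ℝ] E)
      (leftCLM I w (adCLM I x η), leftCLM I x ξ) = leftCLM I (w * x) (η + ξ) := by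
  let Dm : E × E →L[ℝ] E := mfderiv (I.prod I) I (fun p : G × G => p.1 * p.2) (w, x)
  have hm : ∀ p : G × G, p = (w, x) → HasMFDerivAt (I.prod I) I
      (fun p : G × G => p.1 * p.2) p (Dm : E × E →L[ℝ] E) := by
    rintro _ rfl
    exact ((contMDiff_mul I ∞).mdifferentiable (by simp) (w, x)).hasMFDerivAt
  have hl : ∀ y : G, y = 1 → HasMFDerivAt I I (w * ·) y (leftCLM I w : E →L[ℝ] E) := by
    rintro _ rfl
    exact hasMFDerivAt_mul_left I w
  have hw : HasMFDerivAt I I (fun y : G => w * (x * y * x⁻¹)) (1 : G)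
      ((leftCLM I w).comp (adCLM I x) : E →L[ℝ] E) :=
    HasMFDerivAt.comp (1 : G) (hl (x * 1 * x⁻¹) (by simp)) (hasMFDerivAt_conj I x)
  have h1 : HasMFDerivAt I (I.prod I) (fun y : G => (w * (x * y * x⁻¹), x)) (1 : G)
      (((leftCLM I w).comp (adCLM I x)).prod (0 : E →L[ℝ] E) : E →L[ℝ] E × E) :=
    hw.prodMk (hasMFDerivAt_const x (1 : G))
  have h2 : HasMFDerivAt I (I.prod I) (fun y : G => (w, x * y)) (1 : G)
      ((0 : E →L[ℝ] E).prod (leftCLM I x) : E →L[ℝ] E × E) :=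
    (hasMFDerivAt_const w (1 : G)).prodMk (hasMFDerivAt_mul_left I x)
  have e1 : (fun p : G × G => p.1 * p.2) ∘ (fun y : G => (w * (x * y * x⁻¹), x)) =
      fun y => w * x * y := by
    funext y; simp [mul_assoc]
  have e2 : (fun p : G × G => p.1 * p.2) ∘ (fun y : G => (w, x * y)) = fun y => w * x * y := by
    funext y; simp [mul_assoc]
  have h3 := HasMFDerivAt.comp (1 : G) (hm (w * (x * 1 * x⁻¹), x) (by simp)) h1
  have h4 := HasMFDerivAt.comp (1 : G) (hm (w, x * 1) (by simp)) h2
  rw [e1] at h3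
  rw [e2] at h4
  have h5 : Dm.comp (((leftCLM I w).comp (adCLM I x)).prod (0 : E →L[ℝ] E)) = leftCLM I (w * x) :=
    hasMFDerivAt_unique h3 (hasMFDerivAt_mul_left I (w * x))
  have h6 : Dm.comp ((0 : E →L[ℝ] E).prod (leftCLM I x)) = leftCLM I (w * x) :=
    hasMFDerivAt_unique h4 (hasMFDerivAt_mul_left I (w * x))
  have h7 : Dm (leftCLM I w (adCLM I x η), 0) = leftCLM I (w * x) η := by rw [← h5]; rfl
  have h8 : Dm (0, leftCLM I x ξ) = leftCLM I (w * x) ξ := by rw [← h6]; rfl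
  change Dm (leftCLM I w (adCLM I x η), leftCLM I x ξ) = _
  rw [map_add, ← h7, ← h8, ← map_add]
  simp

lemma hasMFDerivAt_mul_curve {w x : ℝ → G} {t : ℝ} {η ξ : E}
    (hw : HasMFDerivAt 𝓘(ℝ, ℝ) I w t
      ((1 : ℝ →L[ℝ] ℝ).smulRight (leftCLM I (w t) (adCLM I (x t) η)) : ℝ →L[ℝ] E))
    (hx : HasMFDerivAt 𝓘(ℝ, ℝ) I x t
      ((1 : ℝ →L[ℝ] ℝ).smulRight (leftCLM I (x t) ξ) : ℝ →L[ℝ] E)) :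
    HasMFDerivAt 𝓘(ℝ, ℝ) I (fun s => w s * x s) t
      ((1 : ℝ →L[ℝ] ℝ).smulRight (leftCLM I (w t * x t) (η + ξ)) : ℝ →L[ℝ] E) := by
  let Dm : E × E →L[ℝ] E := mfderiv (I.prod I) I (fun p : G × G => p.1 * p.2) (w t, x t)
  have hm : HasMFDerivAt (I.prod I) I (fun p : G × G => p.1 * p.2) (w t, x t)
      (Dm : E × E →L[ℝ] E) :=
    ((contMDiff_mul I ∞).mdifferentiable (by simp) (w t, x t)).hasMFDerivAt
  have h1 : HasMFDerivAt 𝓘(ℝ, ℝ) (I.prod I) (fun s => (w s, x s)) t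
      (((1 : ℝ →L[ℝ] ℝ).smulRight (leftCLM I (w t) (adCLM I (x t) η))).prod
        ((1 : ℝ →L[ℝ] ℝ).smulRight (leftCLM I (x t) ξ)) : ℝ →L[ℝ] E × E) := hw.prodMk hx
  have h2 : Dm.comp (((1 : ℝ →L[ℝ] ℝ).smulRight (leftCLM I (w t) (adCLM I (x t) η))).prod
      ((1 : ℝ →L[ℝ] ℝ).smulRight (leftCLM I (x t) ξ))) =
      (1 : ℝ →L[ℝ] ℝ).smulRight (leftCLM I (w t * x t) (η + ξ)) := by
    have h0 : Dm (leftCLM I (w t) (adCLM I (x t) η), leftCLM I (x t) ξ) =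
      leftCLM I (w t * x t) (η + ξ) := mfderiv_mul_apply I (w t) (x t) η ξ
    clear_value Dm
    rw [← h0]
    ext; simp
  have h3 := HasMFDerivAt.comp t hm h1
  exact h3.congr_mfderiv h2

lemma IsTrajectory.contDiff_adCLM {x : ℝ → G} {u : Fin m → ℝ → ℝ} (h : IsTrajectory I X x u) :
    ContDiff ℝ ∞ (fun t => adCLM I (x t)) := by
  refine contDiff_infty_of_hasDerivAt (fun t => hasDerivAt_adCLM_comp I (h.hasMFDerivAt I X t))
    fun n hn => hn.clm_comp ((dAd I G).contDiff.comp ?_)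
  exact ContDiff.sum fun k _ => ((h.smooth k).of_le (by exact_mod_cast le_top)).smul contDiff_const

variable [FiniteDimensional ℝ E]

lemma auxField_eq (xr : ℝ → G) : auxField I X xr =
    fun t w => leftCLM I w (auxVec I X xr t (adCLM I w)) := by
  funext t w
  have h : auxField I X xr t w = ∑ k, trCLM E ((adCLM I w).comp
      (dAd I G (adCLM I (xr t) (X k : E)))) • leftCLM I w (adCLM I (xr t) (X k : E)) :=
    Finset.sum_congr rfl fun k _ => by rw [auxCoeff_eq]; rfl
  rw [h, auxVec, map_sum]
  exact Finset.sum_congr rfl fun k _ => ((leftCLM I w).map_smul _ _).symm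

lemma contMDiff_auxVec {xr : ℝ → G} (hx : ContDiff ℝ ∞ (fun t => adCLM I (xr t))) :
    ContMDiff (𝓘(ℝ, ℝ).prod I) 𝓘(ℝ, E) 1
      (fun p : ℝ × G => auxVec I X xr p.1 (adCLM I p.2)) := by
  have h1 : ContMDiff (𝓘(ℝ, ℝ).prod I) 𝓘(ℝ, E →L[ℝ] E) 1 (fun p : ℝ × G => adCLM I p.2) :=
    ((contMDiff_adCLM I).of_le ENat.LEInfty.out).comp
      (contMDiff_snd (I := 𝓘(ℝ, ℝ)) (J := I) (M := ℝ) (N := G))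
  have h2 : ContMDiff (𝓘(ℝ, ℝ).prod I) 𝓘(ℝ, ℝ × (E →L[ℝ] E)) 1
      (fun p : ℝ × G => (p.1, adCLM I p.2)) :=
    (contMDiff_fst (I := 𝓘(ℝ, ℝ)) (J := I) (M := ℝ) (N := G)).prodMk_space h1
  have h3 : ContMDiff 𝓘(ℝ, ℝ × (E →L[ℝ] E)) 𝓘(ℝ, E) 1
      (fun q : ℝ × (E →L[ℝ] E) => auxVec I X xr q.1 q.2) := (contDiff_auxVec I X hx).contMDiff
  have h4 := h3.comp h2
  exact h4

lemma contMDiff_suspension_auxField {xr : ℝ → G} (hx : ContDiff ℝ ∞ (fun t => adCLM I (xr t))) :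
    ContMDiff (𝓘(ℝ, ℝ).prod I) (𝓘(ℝ, ℝ).prod I).tangent 1
      (fun p => (⟨p, suspension I (auxField I X xr) p⟩ :
        TangentBundle (𝓘(ℝ, ℝ).prod I) (ℝ × G))) := by
  rw [auxField_eq]
  exact contMDiff_suspension_leftCLM I (contMDiff_auxVec I X hx)

lemma existsUnique_isIntegralCurve_auxField [I.Boundaryless] [T2Space G] [CompactSpace G]
    {T : ℝ} (hT : 0 < T) {xr : ℝ → G} (hp : Function.Periodic xr T)
    (hx : ContDiff ℝ ∞ (fun t => adCLM I (xr t))) (t₀ : ℝ) (x₀ : G) :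
    ∃! w : ℝ → G, IsIntegralCurve I (auxField I X xr) w ∧ w t₀ = x₀ := by
  have : IsManifold I 1 G := IsManifold.of_le (n := ∞) (by exact_mod_cast le_top)
  have hY := contMDiff_suspension_auxField I X hx
  obtain ⟨w, hw, hw0⟩ := exists_isIntegralCurve hY hT (auxField_periodic I X hp) t₀ x₀
  exact ⟨w, ⟨hw, hw0⟩, fun w' hw' => eq_of_isIntegralCurve hY hw'.1 hw (hw'.2.trans hw0.symm)⟩

lemma IsIntegralCurve.hasMFDerivAt_auxField {xr w : ℝ → G}
    (hw : IsIntegralCurve I (auxField I X xr) w) (t : ℝ) : HasMFDerivAt 𝓘(ℝ, ℝ) I w t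
      ((1 : ℝ →L[ℝ] ℝ).smulRight (leftCLM I (w t) (auxVec I X xr t (adCLM I (w t)))) :
        ℝ →L[ℝ] E) := by
  rw [auxField_eq] at hw
  exact hw t

lemma contDiff_adCLM_of_isIntegralCurve {xr w : ℝ → G}
    (hx : ContDiff ℝ ∞ (fun t => adCLM I (xr t)))
    (hw : IsIntegralCurve I (auxField I X xr) w) : ContDiff ℝ ∞ (fun t => adCLM I (w t)) :=
  contDiff_infty_of_hasDerivAt
    (fun t => hasDerivAt_adCLM_comp I (hw.hasMFDerivAt_auxField I X t))
    fun _ hn => hn.clm_comp ((dAd I G).contDiff.comp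
      (contDiff_auxVec_comp I X (hx.of_le (by exact_mod_cast le_top)) hn))

lemma monotone_lyapunov_of_isIntegralCurve {xr w : ℝ → G}
    (hw : IsIntegralCurve I (auxField I X xr) w) :
    Monotone (fun t => trCLM E (adCLM I (w t))) := by
  refine monotone_of_hasDerivAt_nonneg (fun t => (trCLM E).hasFDerivAt.comp_hasDerivAt t
    (hasDerivAt_adCLM_comp I (hw.hasMFDerivAt_auxField I X t))) fun t => ?_
  have e : (adCLM I (w t)).comp (dAd I G (auxVec I X xr t (adCLM I (w t)))) =
      ∑ k, trCLM E ((adCLM I (w t)).comp (dAd I G (adCLM I (xr t) (X k : E)))) •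
        (adCLM I (w t)).comp (dAd I G (adCLM I (xr t) (X k : E))) := by
    rw [auxVec, map_sum]
    ext v
    simp
  simp only [Pi.zero_apply, e, map_sum, map_smul, smul_eq_mul]
  exact Finset.sum_nonneg fun k _ => mul_self_nonneg _

lemma tendsto_of_isIntegralCurve_auxField [CompactSpace G] {T : ℝ} (hT : 0 < T) {xr w : ℝ → G}
    (hp : Function.Periodic xr T) (hx : ContDiff ℝ ∞ (fun t => adCLM I (xr t)))
    (hreg : IsRegular I X xr) (hw : IsIntegralCurve I (auxField I X xr) w) {K : Set G}
    (hK : IsCompact K) {z : G} (hz : ∀ y ∈ K, IsLyapunovCritical I y → y = z) {t₀ : ℝ}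
    (hwK : ∀ t, t₀ ≤ t → w t ∈ K) : Tendsto w atTop (𝓝 z) := by
  have hAd : Continuous (adCLM I : G → E →L[ℝ] E) := (contMDiff_adCLM I).continuous
  obtain ⟨R, hR⟩ := isCompact_univ.exists_bound_of_continuousOn hAd.continuousOn
  have key (Z : E) : Tendsto (fun t => trCLM E ((adCLM I (w t)).comp (dAd I G Z))) atTop (𝓝 0) :=
    tendsto_trace_zero (dAd I G) (Y := fun k t => adCLM I (xr t) (X k : E)) hT
      (fun k t => by simp only [hp t])
      (fun k => hx.continuous.clm_apply continuous_const) hreg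
      (fun t => hasDerivAt_adCLM_comp I (hw.hasMFDerivAt_auxField I X t))
      (fun t => hR (w t) trivial) (fun t => trCLM_adCLM_le I G (w t)) Z
  refine hK.tendsto_nhds_of_unique_mapClusterPt
    (eventually_atTop.2 ⟨t₀, fun t ht => hwK t ht⟩) fun y hy hyc => hz y hy fun Z => ?_
  have hcont : Continuous fun x : G => trCLM E ((adCLM I x).comp (dAd I G Z)) :=
    (trCLM E).continuous.comp (hAd.clm_comp continuous_const)
  have hc : MapClusterPt (trCLM E ((adCLM I y).comp (dAd I G Z))) atTop
      (fun t => trCLM E ((adCLM I (w t)).comp (dAd I G Z))) :=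
    MapClusterPt.tendsto_comp (f := fun x : G => trCLM E ((adCLM I x).comp (dAd I G Z)))
      hcont.continuousAt hyc
  have : (𝓝 (trCLM E ((adCLM I y).comp (dAd I G Z))) ⊓ 𝓝 0).NeBot := ClusterPt.mono hc (key Z)
  exact eq_of_nhds_neBot this

lemma auxField_eq_zero_of_isLyapunovCritical {y : G} (hy : IsLyapunovCritical I y) (xr : ℝ → G)
    (t : ℝ) : auxField I X xr t y = 0 := by
  have h : auxVec I X xr t (adCLM I y) = 0 :=
    Finset.sum_eq_zero fun k _ => by rw [hy, zero_smul]
  rw [auxField_eq]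
  exact (congrArg (leftCLM I y) h).trans (map_zero (leftCLM I y))

theorem isLocalAttractor_of_mem_center [I.Boundaryless] [T2Space G] [CompactSpace G]
    [LieAlgebra.HasTrivialRadical ℝ (GroupLieAlgebra I G)] {T : ℝ} (hT : 0 < T) {xr : ℝ → G}
    (hp : Function.Periodic xr T) (hx : ContDiff ℝ ∞ (fun t => adCLM I (xr t)))
    (hreg : IsRegular I X xr) {z : G} (hz : z ∈ Subgroup.center G) :
    IsLocalAttractor I (auxField I X xr) z := by
  obtain ⟨K, hK, hKz, U, hU, hUK⟩ := exists_trapping_neighbourhood I hz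
  refine ⟨fun t => auxField_eq_zero_of_isLyapunovCritical I X
    (isLyapunovCritical_of_adCLM_eq_id I (adCLM_of_mem_center I hz)) xr t, U, hU,
    fun t₀ x₀ hx₀ => ⟨existsUnique_isIntegralCurve_auxField I X hT hp hx t₀ x₀,
      fun w hw hw0 => ?_⟩⟩
  have hwc : Continuous w := continuous_iff_continuousAt.2 fun t => (hw t).continuousAt
  exact tendsto_of_isIntegralCurve_auxField I X hT hp hx hreg hw hK hKz
    (hUK w hwc (monotone_lyapunov_of_isIntegralCurve I X hw) t₀ (hw0 ▸ hx₀))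

/-- Composing the auxiliary flow with the reference trajectory gives a trajectory. -/
lemma IsTrajectory.mul_isIntegralCurve {xr w : ℝ → G} {ur : Fin m → ℝ → ℝ}
    (h : IsTrajectory I X xr ur) (hw : IsIntegralCurve I (auxField I X xr) w) :
    IsTrajectory I X (fun t => w t * xr t) (fun k t => auxCoeff I X xr k t (w t) + ur k t) := by
  have hx := h.contDiff_adCLM I X
  refine ⟨fun k => ContDiff.add ?_ (h.smooth k), fun t => ?_⟩
  · simp only [auxCoeff_eq]
    exact contDiff_auxCoeff_comp I X hx (contDiff_adCLM_of_isIntegralCurve I X hx hw) k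
  · let η : E := ∑ k, auxCoeff I X xr k t (w t) • (X k : E)
    let ξ : E := ∑ k, ur k t • (X k : E)
    have e1 (L : E →L[ℝ] E) (v : Fin m → E) (c : Fin m → ℝ) :
        L (∑ k, c k • v k) = ∑ k, c k • L (v k) := by simp [map_sum]
    have hη : auxVec I X xr t (adCLM I (w t)) = adCLM I (xr t) η := by
      refine Eq.trans ?_ (e1 (adCLM I (xr t)) X fun k => auxCoeff I X xr k t (w t)).symm
      exact Finset.sum_congr rfl fun k _ => by rw [auxCoeff_eq]
    have hw' := hw.hasMFDerivAt_auxField I X t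
    rw [hη] at hw'
    refine (hasMFDerivAt_mul_curve I hw' (h.hasMFDerivAt I X t)).congr_mfderiv ?_
    refine congrArg (fun v : E => (1 : ℝ →L[ℝ] ℝ).smulRight v) ?_
    have e2 (v : Fin m → E) (c d : Fin m → ℝ) :
        ∑ k, c k • v k + ∑ k, d k • v k = ∑ k, (c k + d k) • v k := by
      simp [add_smul, Finset.sum_add_distrib]
    have e3 : η + ξ = ∑ k, (auxCoeff I X xr k t (w t) + ur k t) • (X k : E) := e2 X _ _
    exact (congrArg (leftCLM I (w t * xr t)) e3).trans (e1 (leftCLM I (w t * xr t)) X _)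

end Tracking

end

end TrajectoryTracking

theorem mainTheorem1
    {E : Type*} [NormedAddCommGroup E] [NormedSpace ℝ E] [FiniteDimensional ℝ E]
    {H : Type*} [TopologicalSpace H] (I : ModelWithCorners ℝ E H) [I.Boundaryless]
    {G : Type*} [TopologicalSpace G] [ChartedSpace H G] [Group G] [LieGroup I ∞ G]
    [T2Space G] [CompactSpace G] [ConnectedSpace G]
    -- `G` is semisimple: its Lie algebra has no nonzero solvable ideal
    [LieAlgebra.HasTrivialRadical ℝ (GroupLieAlgebra I G)]
    {m : ℕ} (X : Fin m → GroupLieAlgebra I G)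
    -- the regular `T`-periodic reference trajectory
    (T : ℝ) (hT : 0 < T) (xr : ℝ → G) (ur : Fin m → ℝ → ℝ)
    (htraj : TrajectoryTracking.IsTrajectory I X xr ur)
    (hper : TrajectoryTracking.IsPeriodicTrajectory T xr ur)
    (hreg : TrajectoryTracking.IsRegular I X xr) :
    (∀ z ∈ Subgroup.center G,
      TrajectoryTracking.IsLocalAttractor I (TrajectoryTracking.auxField I X xr) z) ∧
    TrajectoryTracking.IsLocalAttractor I (TrajectoryTracking.auxField I X xr) (1 : G) ∧
    ∃ U ∈ 𝓝 (xr 0), ∀ x₀ ∈ U,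
      (∃! w : ℝ → G,
        TrajectoryTracking.IsIntegralCurve I (TrajectoryTracking.auxField I X xr) w ∧
          w 0 = x₀ * (xr 0)⁻¹) ∧
      ∀ w : ℝ → G,
        TrajectoryTracking.IsIntegralCurve I (TrajectoryTracking.auxField I X xr) w →
        w 0 = x₀ * (xr 0)⁻¹ →
        TrajectoryTracking.SolvesTracking I X xr x₀ (fun t => w t * xr t)
          (fun k t => TrajectoryTracking.auxCoeff I X xr k t (w t) + ur k t) := by
  have hx := htraj.contDiff_adCLM I X
  have hatt : ∀ z ∈ Subgroup.center G,
      TrajectoryTracking.IsLocalAttractor I (TrajectoryTracking.auxField I X xr) z := fun z hz =>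
    TrajectoryTracking.isLocalAttractor_of_mem_center I X hT hper.1 hx hreg hz
  refine ⟨hatt, hatt 1 (one_mem _), ?_⟩
  obtain ⟨-, U, hU, hUw⟩ := hatt 1 (one_mem _)
  have hcont : Continuous fun x₀ : G => x₀ * (xr 0)⁻¹ :=
    have := topologicalGroup_of_lieGroup I ∞ (G := G)
    continuous_mul_const _
  refine ⟨(fun x₀ : G => x₀ * (xr 0)⁻¹) ⁻¹' U,
    hcont.continuousAt.preimage_mem_nhds (by rwa [mul_inv_cancel]), fun x₀ hx₀ => ?_⟩
  obtain ⟨hex, hlim⟩ := hUw 0 _ hx₀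
  refine ⟨hex, fun w hw hw0 => ⟨htraj.mul_isIntegralCurve I X hw, by simp [hw0], ?_⟩⟩
  simpa using hlim w hw hw0
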